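/- Consider two parties with inputs $x,y\in\{0,1\}$ and outputs $a,b\in\{0,1\}$. For a behaviour $p(ab|xy)$ put $\langle A_xB_y\rangle=\sum_{a,b}(-1)^{a+b}p(ab|xy)$. For $\theta,\phi,\omega\in\mathbb{R}$ define the Bell expression $$\langle B_{\theta,\phi,\omega}\rangle=\cos(\theta+\phi)\cos(\theta+\omega)\big(\cos\omega\,\langle A_0B_0\rangle-\cos\phi\,\langle A_0B_1\rangle\big)+\cos\phi\cos\omega\big(-\cos(\theta+\omega)\langle A_1B_0\rangle+\cos(\theta+\phi)\langle A_1B_1\rangle\big).$$ A behaviour is local if it has a local hidden variable model. A quantum strategy consists of a density operator $\tilde\rho$ on $\tilde H_A\otimes\tilde H_B$, with $\tilde H_A,\tilde H_B$ of arbitrary finite dimensions, and two-outcome projective measurements $\{\tilde M_{a|x}\}_a$ on $\tilde H_A$ and $\{\tilde N_{b|y}\}_b$ on $\tilde H_B$; its behaviour is $p(ab|xy)=\mathrm{Tr}[(\tilde M_{a|x}\otimes\tilde N_{b|y})\tilde\rho]$ and its observables are $\tilde A_x=\tilde M_{0|x}-\tilde M_{1|x}$, $\tilde B_y=\tilde N_{0|y}-\tilde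 N_{1|y}$. Let $$\eta^{\mathrm L}=\max_{\pm}\Big\{\big|\cos(\theta+\omega)\cos\omega\,(\cos(\theta+\phi)\pm\cos\phi)\big|+\big|\cos(\theta+\phi)\cos\phi\,(\cos(\theta+\omega)\pm\cos\omega)\big|\Big\},$$ $$\eta^{\mathrm Q}=\sin\theta\,\sin(\omega-\phi)\,\sin(\theta+\omega+\phi),$$ and consider the condition $$\cos(\theta+\phi)\cos\phi\,\cos(\theta+\omega)\cos\omega<0.\qquad(*)$$ Then: (i) The local bounds are $\pm\eta^{\mathrm L}$: the maximum of $\langle B_{\theta,\phi,\omega}\rangle$ over local behaviours is $\eta^{\mathrm L}$ and the minimum is $-\eta^{\mathrm L}$. (ii) If $(*)$ holds, the quantum bounds are $\pm\eta^{\mathrm Q}$: the maximum of $\langle B_{\theta,\phi,\omega}\rangle$ over quantum strategies is $|\eta^{\mathrm Q}|$ and the minimum is $-|\eta^{\mathrm Q}|$. (iii) $|\eta^{\mathrm Q}|>\eta^{\mathrm L}$ if and only if $(*)$ holds. (iv) If $(*)$ holds then, up to local isometries, there is a unique quantum strategy that achieves $\langle B_{\theta,\phi,\omega}\rangle=\eta^{\mathrm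 Q}$, namely $$|\psi\rangle=\tfrac{1}{\sqrt2}(|00\rangle+i|11\rangle),\quad A_0=\sigma_X,\quad A_1=\cos\theta\,\sigma_X+\sin\theta\,\sigma_Y,\quad B_0=\cos\phi\,\sigma_X+\sin\phi\,\sigma_Y,\quad B_1=\cos\omega\,\sigma_X+\sin\omega\,\sigma_Y .$$ That is, this strategy achieves $\eta^{\mathrm Q}$, and for every quantum strategy that achieves $\eta^{\mathrm Q}$ there are finite-dimensional spaces $J_A,J_B$ and isometries $V_A:\tilde H_A\to\mathbb{C}^2\otimes J_A$ and $V_B:\tilde H_B\to\mathbb{C}^2\otimes J_B$ such that for every purification $|\Psi\rangle\in E\otimes\tilde H_A\otimes\tilde H_B$ of $\tilde\rho$ (with $E$ finite-dimensional) there is a unit vector $|\xi\rangle\in E\otimes J_A\otimes J_B$ with $$(\mathbb{I}_E\otimes V_A\otimes V_B)(\mathbb{I}_E\otimes\tilde A_x\otimes\tilde B_y)|\Psi\rangle=|\xi\rangle\otimes(A_x\otimes B_y)|\psi\rangle$$ (up to the order of the tensor factors) for all $x,y$, and the same holds when $\tilde A_x,A_x$, or $\tilde B_y,B_y$, or both pairs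 are replaced by identity operators. -/

import Mathlib

open Matrix MeasureTheory
open scoped Kronecker ComplexOrder

noncomputable section

namespace BellSelfTest

/-- A behaviour `p a b x y = p(ab|xy)` with inputs `x, y ∈ {0,1}` and outputs `a, b ∈ {0,1}`. -/
abbrev Behaviour : Type := Fin 2 → Fin 2 → Fin 2 → Fin 2 → ℝ

/-- The correlator `⟨A_x B_y⟩ = ∑_{a,b} (-1)^(a+b) p(ab|xy)`. -/
def corr (p : Behaviour) (x y : Fin 2) : ℝ :=
  ∑ a : Fin 2, ∑ b : Fin 2, (-1 : ℝ) ^ (a.val + b.val) * p a b x y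

/-- The Bell expression `⟨B_{θ,φ,ω}⟩`. -/
def bell (θ φ ω : ℝ) (p : Behaviour) : ℝ :=
  Real.cos (θ + φ) * Real.cos (θ + ω) *
      (Real.cos ω * corr p 0 0 - Real.cos φ * corr p 0 1) +
    Real.cos φ * Real.cos ω *
      (-Real.cos (θ + ω) * corr p 1 0 + Real.cos (θ + φ) * corr p 1 1)

/-- The local value: the maximum over the two choices of sign. -/
def etaL (θ φ ω : ℝ) : ℝ :=
  max
    (|Real.cos (θ + ω) * Real.cos ω * (Real.cos (θ + φ) + Real.cos φ)| +
      |Real.cos (θ + φ) * Real.cos φ * (Real.cos (θ + ω) + Real.cos ω)|)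
    (|Real.cos (θ + ω) * Real.cos ω * (Real.cos (θ + φ) - Real.cos φ)| +
      |Real.cos (θ + φ) * Real.cos φ * (Real.cos (θ + ω) - Real.cos ω)|)

/-- The quantum value. -/
def etaQ (θ φ ω : ℝ) : ℝ :=
  Real.sin θ * Real.sin (ω - φ) * Real.sin (θ + ω + φ)

/-- A behaviour is local if it has a local hidden variable model: a probability space `(Ω, μ)` of
hidden variables and measurable response functions `P x a l = p(a|x,l)`, `Q y b l = p(b|y,l)`. -/
def IsLocal (p : Behaviour) : Prop :=
  ∃ (Ω : Type) (_ : MeasurableSpace Ω) (μ : Measure Ω) (P Q : Fin 2 → Fin 2 → Ω → ℝ),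
    IsProbabilityMeasure μ ∧
    (∀ x a, Measurable (P x a)) ∧ (∀ y b, Measurable (Q y b)) ∧
    (∀ x a l, 0 ≤ P x a l) ∧ (∀ y b l, 0 ≤ Q y b l) ∧
    (∀ x l, ∑ a, P x a l = 1) ∧ (∀ y l, ∑ b, Q y b l = 1) ∧
    ∀ a b x y, p a b x y = ∫ l, P x a l * Q y b l ∂μ

/-- A two-outcome projective measurement on `ℂ^d`. -/
structure IsProjMeas {d : ℕ} (M : Fin 2 → Matrix (Fin d) (Fin d) ℂ) : Prop where
  herm : ∀ a, (M a).IsHermitian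
  idem : ∀ a, M a * M a = M a
  sum_eq_one : ∑ a, M a = 1

/-- A quantum strategy on `ℂ^dA ⊗ ℂ^dB`: a density operator and, for each input, a projective
measurement of each party (`M x a` for the first, `N y b` for the second). -/
structure QStrategy (dA dB : ℕ) where
  ρ : Matrix (Fin dA × Fin dB) (Fin dA × Fin dB) ℂ
  M : Fin 2 → Fin 2 → Matrix (Fin dA) (Fin dA) ℂ
  N : Fin 2 → Fin 2 → Matrix (Fin dB) (Fin dB) ℂ
  posSemidef : ρ.PosSemidef
  trace_eq_one : ρ.trace = 1
  projM : ∀ x, IsProjMeas (M x)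
  projN : ∀ y, IsProjMeas (N y)

namespace QStrategy

variable {dA dB : ℕ}

/-- The Born rule. -/
def behaviour (S : QStrategy dA dB) : Behaviour :=
  fun a b x y => (((S.M x a) ⊗ₖ (S.N y b)) * S.ρ).trace.re

/-- The observables `A_x = M_{0|x} - M_{1|x}`. -/
def obsA (S : QStrategy dA dB) (x : Fin 2) : Matrix (Fin dA) (Fin dA) ℂ := S.M x 0 - S.M x 1

/-- The observables `B_y = N_{0|y} - N_{1|y}`. -/
def obsB (S : QStrategy dA dB) (y : Fin 2) : Matrix (Fin dB) (Fin dB) ℂ := S.N y 0 - S.N y 1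

end QStrategy

/-- A behaviour is quantum if some quantum strategy, in some finite dimensions, generates it. -/
def IsQuantum (p : Behaviour) : Prop :=
  ∃ (dA dB : ℕ) (S : QStrategy dA dB), S.behaviour = p

/-- `v` is a unit vector for the Euclidean (Hilbert space) norm. -/
def IsUnitVec {ι : Type} [Fintype ι] (v : ι → ℂ) : Prop := ∑ i, ‖v i‖ ^ 2 = 1

/-- `Ψ ∈ E ⊗ A ⊗ B` purifies `ρ` on `A ⊗ B`: the partial trace of `|Ψ⟩⟨Ψ|` over `E` is `ρ`. -/
def IsPurification {dE dA dB : ℕ} (Ψ : Fin dE × Fin dA × Fin dB → ℂ)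
    (ρ : Matrix (Fin dA × Fin dB) (Fin dA × Fin dB) ℂ) : Prop :=
  ∀ i j, ∑ e, Ψ (e, i) * star (Ψ (e, j)) = ρ i j

/-- The operator selected by an optional input: the identity if no input is given. -/
def opOf {d : ℕ} (A : Fin 2 → Matrix (Fin d) (Fin d) ℂ) : Option (Fin 2) →
    Matrix (Fin d) (Fin d) ℂ
  | none => 1
  | some x => A x

/-- `f = η` self-tests the two-qubit pure state `ψ` and the qubit observables `A x`, `B y`: every
quantum strategy of value `η` is mapped, by local isometries `V_A : H_A → ℂ² ⊗ J_A` and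
`V_B : H_B → ℂ² ⊗ J_B` and for every purification `Ψ` on `E ⊗ H_A ⊗ H_B`, to the target
tensored with a junk state `ξ` of `E ⊗ J_A ⊗ J_B`. Besides all pairs of observables, the relation
includes the identity in place of either or both of them, so that the states themselves and the
action of the observables of one party are covered too. -/
def SelfTests (f : Behaviour → ℝ) (η : ℝ) (ψ : Fin 2 × Fin 2 → ℂ)
    (A B : Fin 2 → Matrix (Fin 2) (Fin 2) ℂ) : Prop :=
  ∀ (dA dB : ℕ) (S : QStrategy dA dB), f S.behaviour = η →
    ∃ (kA kB : ℕ) (VA : Matrix (Fin 2 × Fin kA) (Fin dA) ℂ)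
      (VB : Matrix (Fin 2 × Fin kB) (Fin dB) ℂ),
      VAᴴ * VA = 1 ∧ VBᴴ * VB = 1 ∧
      ∀ (dE : ℕ) (Ψ : Fin dE × Fin dA × Fin dB → ℂ), IsPurification Ψ S.ρ →
        ∃ ξ : Fin dE × Fin kA × Fin kB → ℂ, IsUnitVec ξ ∧
          ∀ (x y : Option (Fin 2)) (e : Fin dE) (i j : Fin 2) (s : Fin kA) (t : Fin kB),
            (((1 : Matrix (Fin dE) (Fin dE) ℂ) ⊗ₖ (VA ⊗ₖ VB)) *ᵥ
              (((1 : Matrix (Fin dE) (Fin dE) ℂ) ⊗ₖ (opOf S.obsA x ⊗ₖ opOf S.obsB y)) *ᵥ Ψ))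
                (e, (i, s), (j, t)) =
            ξ (e, s, t) * ((opOf A x ⊗ₖ opOf B y) *ᵥ ψ) (i, j)

/-- The Pauli matrix `σ_X`. -/
def pauliX : Matrix (Fin 2) (Fin 2) ℂ := !![0, 1; 1, 0]

/-- The Pauli matrix `σ_Y`. -/
def pauliY : Matrix (Fin 2) (Fin 2) ℂ := !![0, -Complex.I; Complex.I, 0]

/-- The observable `cos α σ_X + sin α σ_Y`. -/
def xyObs (α : ℝ) : Matrix (Fin 2) (Fin 2) ℂ :=
  ((Real.cos α : ℝ) : ℂ) • pauliX + ((Real.sin α : ℝ) : ℂ) • pauliY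

/-- The target state `(|00⟩ + i|11⟩)/√2`. -/
def targetState : Fin 2 × Fin 2 → ℂ := fun k =>
  if k = (0, 0) then 1 / ((Real.sqrt 2 : ℝ) : ℂ)
  else if k = (1, 1) then Complex.I / ((Real.sqrt 2 : ℝ) : ℂ)
  else 0

/-- Alice's target observables. -/
def targetA (θ : ℝ) : Fin 2 → Matrix (Fin 2) (Fin 2) ℂ := ![pauliX, xyObs θ]

/-- Bob's target observables. -/
def targetB (φ ω : ℝ) : Fin 2 → Matrix (Fin 2) (Fin 2) ℂ := ![xyObs φ, xyObs ω]

end BellSelfTest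

end

/-!
Write `a = cos (θ + φ)`, `b = cos (θ + ω)`, `c = cos φ`, `d = cos ω` and `s = sin (ω - φ)`. The Bell
operator is `a b A₀ (d B₀ - c B₁) + c d A₁ (a B₁ - b B₀)`, and `η^Q = s (c d - a b)`.

*Local bound.* A local value is an average over hidden variables of the values of product
strategies with mean outcomes in `[-1, 1]`. After maximising over the second party, such a value is
a convex function on the square of the first party's means, so its maximum is at a vertex
(`abs_add_abs_le_etaL`).

*Quantum bound.* For a sign `ε` put `K₀ = s ε A₀ - (c B₁ - d B₀)` and
`K₁ = s ε A₁ - (a B₁ - b B₀)`. In `c d K₁² - a b K₀²` the anticommutator of `B₀` and `B₁` cancels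
and what remains is `2 s (η^Q - ε ⟨B⟩)` (`QStrategy.sum_of_squares`). If `a b c d < 0`, both
squares enter with the same sign, so `|⟨B⟩| ≤ |η^Q|`; if the value is `η^Q`, then `K₀` and `K₁`
annihilate every purification.

*The gap.* In half-angle coordinates `p = φ + θ / 2`, `q = ω + θ / 2` one has
`a c = cos² p - sin² (θ / 2)` and `b d = cos² q - sin² (θ / 2)`, and the comparison of the two
values becomes an elementary inequality whose strictness depends on whether `|sin (θ / 2)|`
separates `|cos p|` from `|cos q|` (`etaL_lt_abs_etaQ_iff`).

*Self-testing.* On an optimal state the relations `K₀ = K₁ = 0`, squared, fix the anticommutators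
`{A₀, A₁} = 2 cos θ` and `{B₀, B₁} = 2 cos (ω - φ)` (`anticommutator_mul`). The spectral projection
of such an anticommutator for this eigenvalue commutes with the observables and fixes the state, and
on its range two linear combinations of the observables satisfy the relations of `σ_X` and `σ_Y`.
A swap isometry, extended to the complement of the range, carries them to the Pauli matrices
(`exists_isometry_intertwining`). In the image the relations `K₀ = K₁ = 0` become
`σ_X ⊗ 1 = 1 ⊗ σ_Y` and `σ_Y ⊗ 1 = 1 ⊗ σ_X`, whose only common solution is the target state tensored
with an arbitrary junk state (`amplitudes_of_optimal`).
-/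

/-! ### Trigonometric identities and the comparison of the two bounds -/

namespace BellSelfTest

theorem etaQ_eq (θ φ ω : ℝ) :
    etaQ θ φ ω = Real.sin (ω - φ) *
      (Real.cos φ * Real.cos ω - Real.cos (θ + φ) * Real.cos (θ + ω)) := by
  have h1 := Real.sin_sq_add_cos_sq θ
  simp only [etaQ, Real.sin_add, Real.cos_add, Real.sin_sub]
  linear_combination (Real.sin ω * Real.cos φ - Real.cos ω * Real.sin φ) *
    (Real.cos φ * Real.cos ω) * h1

theorem cos_mul_cos_sub_cos_mul_cos (θ φ ω : ℝ) :
    Real.cos (θ + φ) * Real.cos ω - Real.cos (θ + ω) * Real.cos φ =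
      Real.sin θ * Real.sin (ω - φ) := by
  simp only [Real.cos_add, Real.sin_sub]
  ring

theorem sin_sub_sq (α β : ℝ) :
    Real.sin (β - α) ^ 2 = Real.cos α ^ 2 + Real.cos β ^ 2 -
      2 * (Real.cos α * Real.cos β) * Real.cos (β - α) := by
  have h1 := Real.sin_sq_add_cos_sq α
  have h2 := Real.sin_sq_add_cos_sq β
  simp only [Real.cos_sub, Real.sin_sub]
  linear_combination (Real.cos β ^ 2) * h1 + Real.cos α ^ 2 * h2

/-- The identity that fixes the constant term in the sum-of-squares decomposition of the
Bell operator. -/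
theorem sum_of_squares_constant (θ φ ω : ℝ) :
    Real.cos φ * Real.cos ω * (Real.cos (θ + φ) ^ 2 + Real.cos (θ + ω) ^ 2) -
      Real.cos (θ + φ) * Real.cos (θ + ω) * (Real.cos φ ^ 2 + Real.cos ω ^ 2) =
    Real.sin (ω - φ) ^ 2 *
      (Real.cos φ * Real.cos ω - Real.cos (θ + φ) * Real.cos (θ + ω)) := by
  have e1 := sin_sub_sq φ ω
  have e2 := sin_sub_sq (θ + φ) (θ + ω)
  have e3 : θ + ω - (θ + φ) = ω - φ := by ring
  rw [e3] at e2
  linear_combination (Real.cos (θ + φ) * Real.cos (θ + ω)) * e1 -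
    (Real.cos φ * Real.cos ω) * e2

theorem sin_ne_zero_of_cos_prod_neg {θ φ ω : ℝ}
    (h : Real.cos (θ + φ) * Real.cos φ * Real.cos (θ + ω) * Real.cos ω < 0) :
    Real.sin θ ≠ 0 ∧ Real.sin (ω - φ) ≠ 0 := by
  rw [← mul_ne_zero_iff, ← cos_mul_cos_sub_cos_mul_cos]
  intro h0
  have h1 := sub_eq_zero.mp h0
  have : Real.cos (θ + φ) * Real.cos φ * Real.cos (θ + ω) * Real.cos ω =
      (Real.cos (θ + ω) * Real.cos φ) ^ 2 := by
    linear_combination (Real.cos φ * Real.cos (θ + ω)) * h1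
  nlinarith [sq_nonneg (Real.cos (θ + ω) * Real.cos φ)]

theorem mul_abs_sq_sub_sq_le {r u v : ℝ} (hr : 0 ≤ r) (hu : r ≤ u) (hv : r ≤ v) :
    r * |u ^ 2 - v ^ 2| ≤ |v ^ 2 - r ^ 2| * u + |u ^ 2 - r ^ 2| * v := by
  have h1 : 0 ≤ v ^ 2 - r ^ 2 := by nlinarith
  have h2 : 0 ≤ u ^ 2 - r ^ 2 := by nlinarith
  rw [abs_of_nonneg h1, abs_of_nonneg h2]
  rcases abs_cases (u ^ 2 - v ^ 2) with ⟨h, -⟩ | ⟨h, -⟩ <;> rw [h] <;>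
    nlinarith [mul_nonneg h1 (sub_nonneg.2 hu), mul_nonneg h2 (sub_nonneg.2 hv),
      mul_nonneg h1 hr, mul_nonneg h2 hr]

/-- If `r` lies strictly between `u` and `v`, the two sides differ by a positive multiple of
`(u - r) * (r - v)`. -/
theorem lt_mul_abs_sq_sub_sq {r u v : ℝ} (hr : 0 ≤ r) (hu : 0 ≤ u) (hv : 0 ≤ v)
    (h : (u ^ 2 - r ^ 2) * (v ^ 2 - r ^ 2) < 0) :
    |v ^ 2 - r ^ 2| * u + |u ^ 2 - r ^ 2| * v < r * |u ^ 2 - v ^ 2| := by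
  rcases mul_neg_iff.mp h with ⟨h1, h2⟩ | ⟨h1, h2⟩
  · have k1 : r < u := by nlinarith
    have k2 : v < r := by nlinarith
    rw [abs_of_pos h1, abs_of_neg h2, abs_of_pos (by linarith)]
    nlinarith [mul_pos (mul_pos (sub_pos.2 k1) (sub_pos.2 k2)) (sub_pos.2 (k2.trans k1))]
  · have k1 : u < r := by nlinarith
    have k2 : r < v := by nlinarith
    rw [abs_of_neg h1, abs_of_pos h2, abs_of_neg (by linarith)]
    nlinarith [mul_pos (mul_pos (sub_pos.2 k1) (sub_pos.2 k2)) (sub_pos.2 (k1.trans k2))]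

/-- The local value in half-angle coordinates. The first entry of the maximum is governed by the
cosines of `φ + θ / 2` and `ω + θ / 2`, the second one by their sines. -/
theorem etaL_half_angle (t p q : ℝ) :
    etaL (2 * t) (p - t) (q - t) =
      max (2 * |Real.cos t| *
          (|Real.cos q ^ 2 - Real.sin t ^ 2| * |Real.cos p| +
            |Real.cos p ^ 2 - Real.sin t ^ 2| * |Real.cos q|))
        (2 * |Real.sin t| *
          (|Real.sin q ^ 2 - Real.cos t ^ 2| * |Real.sin p| +
            |Real.sin p ^ 2 - Real.cos t ^ 2| * |Real.sin q|)) := by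
  have e : ∀ r, 2 * t + (r - t) = r + t := fun r => by ring
  have k : ∀ r, Real.cos (r + t) * Real.cos (r - t) = Real.cos r ^ 2 - Real.sin t ^ 2 := by
    intro r
    have h1 := Real.sin_sq_add_cos_sq r
    have h2 := Real.sin_sq_add_cos_sq t
    simp only [Real.cos_add, Real.cos_sub]
    linear_combination Real.cos r ^ 2 * h2 - Real.sin t ^ 2 * h1
  have k' : ∀ r, Real.sin r ^ 2 - Real.cos t ^ 2 = -(Real.cos r ^ 2 - Real.sin t ^ 2) := by
    intro r
    linear_combination Real.sin_sq_add_cos_sq r - Real.sin_sq_add_cos_sq t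
  have c1 : ∀ r, Real.cos (r + t) + Real.cos (r - t) = 2 * (Real.cos t * Real.cos r) := by
    intro r; simp only [Real.cos_add, Real.cos_sub]; ring
  have c2 : ∀ r, Real.cos (r + t) - Real.cos (r - t) = -(2 * (Real.sin t * Real.sin r)) := by
    intro r; simp only [Real.cos_add, Real.cos_sub]; ring
  simp only [etaL, e, c1, c2, k, k', abs_mul, abs_neg, abs_two]
  congr 1 <;> ring

theorem etaQ_half_angle (t p q : ℝ) :
    |etaQ (2 * t) (p - t) (q - t)| =
      2 * |Real.sin t| * |Real.cos t| * |Real.cos p ^ 2 - Real.cos q ^ 2| := by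
  have e : etaQ (2 * t) (p - t) (q - t) =
      2 * Real.sin t * Real.cos t * (Real.cos p ^ 2 - Real.cos q ^ 2) := by
    have h1 := Real.sin_sq_add_cos_sq p
    have h2 := Real.sin_sq_add_cos_sq q
    have e1 : q - t - (p - t) = q - p := by ring
    have e2 : 2 * t + (q - t) + (p - t) = q + p := by ring
    rw [etaQ, e1, e2, Real.sin_two_mul, Real.sin_sub, Real.sin_add]
    linear_combination 2 * Real.sin t * Real.cos t *
      (Real.cos p ^ 2 * h2 - Real.cos q ^ 2 * h1)
  rw [e]
  simp [abs_mul]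

/-- The quantum value exceeds the local one exactly when `|sin (θ / 2)|` separates
`|cos (φ + θ / 2)|` from `|cos (ω + θ / 2)|`. -/
theorem etaL_lt_abs_etaQ_iff (θ φ ω : ℝ) :
    etaL θ φ ω < |etaQ θ φ ω| ↔
      Real.cos (θ + φ) * Real.cos φ * Real.cos (θ + ω) * Real.cos ω < 0 := by
  obtain ⟨t, rfl⟩ : ∃ t, θ = 2 * t := ⟨θ / 2, by ring⟩
  obtain ⟨p, rfl⟩ : ∃ p, φ = p - t := ⟨φ + t, by ring⟩
  obtain ⟨q, rfl⟩ : ∃ q, ω = q - t := ⟨ω + t, by ring⟩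
  have hprod : Real.cos (2 * t + (p - t)) * Real.cos (p - t) * Real.cos (2 * t + (q - t)) *
      Real.cos (q - t) =
      (Real.cos p ^ 2 - Real.sin t ^ 2) * (Real.cos q ^ 2 - Real.sin t ^ 2) := by
    have k : ∀ r, Real.cos (2 * t + (r - t)) * Real.cos (r - t) =
        Real.cos r ^ 2 - Real.sin t ^ 2 := by
      intro r
      have h1 := Real.sin_sq_add_cos_sq r
      have h2 := Real.sin_sq_add_cos_sq t
      rw [show 2 * t + (r - t) = r + t by ring, Real.cos_add, Real.cos_sub]
      linear_combination Real.cos r ^ 2 * h2 - Real.sin t ^ 2 * h1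
    rw [k p, mul_assoc, k q]
  have k' : ∀ r, Real.sin r ^ 2 - Real.cos t ^ 2 = -(Real.cos r ^ 2 - Real.sin t ^ 2) := by
    intro r
    linear_combination Real.sin_sq_add_cos_sq r - Real.sin_sq_add_cos_sq t
  have kpq : Real.sin p ^ 2 - Real.sin q ^ 2 = -(Real.cos p ^ 2 - Real.cos q ^ 2) := by
    linear_combination Real.sin_sq_add_cos_sq p - Real.sin_sq_add_cos_sq q
  have kpq' : |Real.sin p ^ 2 - Real.sin q ^ 2| = |Real.cos p ^ 2 - Real.cos q ^ 2| := by
    rw [kpq, abs_neg]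
  rw [hprod, etaL_half_angle, etaQ_half_angle]
  constructor
  · intro h
    by_contra! hn
    rw [max_lt_iff] at h
    rcases mul_nonneg_iff.mp hn with ⟨h1, h2⟩ | ⟨h1, h2⟩
    · have := mul_abs_sq_sub_sq_le (abs_nonneg (Real.sin t))
        (sq_le_sq.mp (sub_nonneg.mp h1)) (sq_le_sq.mp (sub_nonneg.mp h2))
      simp only [sq_abs] at this
      nlinarith [mul_le_mul_of_nonneg_left this (abs_nonneg (Real.cos t)), h.1]
    · have h1' : 0 ≤ Real.sin p ^ 2 - Real.cos t ^ 2 := by rw [k']; linarith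
      have h2' : 0 ≤ Real.sin q ^ 2 - Real.cos t ^ 2 := by rw [k']; linarith
      have := mul_abs_sq_sub_sq_le (abs_nonneg (Real.cos t))
        (sq_le_sq.mp (sub_nonneg.mp h1')) (sq_le_sq.mp (sub_nonneg.mp h2'))
      simp only [sq_abs, kpq'] at this
      nlinarith [mul_le_mul_of_nonneg_left this (abs_nonneg (Real.sin t)), h.2]
  · intro h
    have ht1 : 0 < |Real.cos t| := by
      rw [abs_pos]
      intro h0
      have h1 := k' p
      have h2 := k' q
      rw [h0] at h1 h2
      nlinarith [mul_nonneg (sq_nonneg (Real.sin p)) (sq_nonneg (Real.sin q))]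
    have ht2 : 0 < |Real.sin t| := by
      rw [abs_pos]
      intro h0
      rw [h0] at h
      nlinarith [mul_nonneg (sq_nonneg (Real.cos p)) (sq_nonneg (Real.cos q))]
    rw [max_lt_iff]
    constructor
    · have := lt_mul_abs_sq_sub_sq (abs_nonneg (Real.sin t)) (abs_nonneg (Real.cos p))
        (abs_nonneg (Real.cos q)) (by simpa only [sq_abs] using h)
      simp only [sq_abs] at this
      nlinarith [mul_lt_mul_of_pos_left this ht1]
    · have := lt_mul_abs_sq_sub_sq (abs_nonneg (Real.cos t)) (abs_nonneg (Real.sin p))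
        (abs_nonneg (Real.sin q)) (by simp only [sq_abs, k']; linarith)
      simp only [sq_abs, kpq'] at this
      nlinarith [mul_lt_mul_of_pos_left this ht2]

/-! ### Local behaviours -/

/-- The Bell expression as a function of the correlators `α x * β y` of a product strategy with
mean outcomes `α x` and `β y`. -/
theorem bell_eq_of_corr_eq_mul {θ φ ω : ℝ} {p : Behaviour} {α β : Fin 2 → ℝ}
    (h : ∀ x y, corr p x y = α x * β y) :
    bell θ φ ω p =
      β 0 * (Real.cos (θ + ω) * Real.cos ω * (Real.cos (θ + φ) * α 0 - Real.cos φ * α 1)) +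
      β 1 * (-(Real.cos (θ + φ) * Real.cos φ * (Real.cos (θ + ω) * α 0 - Real.cos ω * α 1))) := by
  simp only [bell, h]
  ring

/-- A product strategy has mean outcomes in the square `[-1, 1]²`, on which the value, maximised
over the second party, is a convex function; so it is largest at a vertex. -/
theorem abs_add_abs_le_etaL (θ φ ω : ℝ) {α₀ α₁ : ℝ} (h₀ : |α₀| ≤ 1) (h₁ : |α₁| ≤ 1) :
    |Real.cos (θ + ω) * Real.cos ω * (Real.cos (θ + φ) * α₀ - Real.cos φ * α₁)| +
      |Real.cos (θ + φ) * Real.cos φ * (Real.cos (θ + ω) * α₀ - Real.cos ω * α₁)| ≤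
    etaL θ φ ω := by
  set a := Real.cos (θ + φ)
  set b := Real.cos (θ + ω)
  set c := Real.cos φ
  set d := Real.cos ω
  have e1 : b * d * (a * α₀ - c * α₁) =
      (α₀ - α₁) / 2 * (b * d * (a + c)) + (α₀ + α₁) / 2 * (b * d * (a - c)) := by ring
  have e2 : a * c * (b * α₀ - d * α₁) =
      (α₀ - α₁) / 2 * (a * c * (b + d)) + (α₀ + α₁) / 2 * (a * c * (b - d)) := by ring
  have huv : |(α₀ - α₁) / 2| + |(α₀ + α₁) / 2| ≤ 1 := by
    rw [abs_le] at h₀ h₁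
    rcases abs_cases ((α₀ - α₁) / 2) with ⟨h, -⟩ | ⟨h, -⟩ <;>
      rcases abs_cases ((α₀ + α₁) / 2) with ⟨h', -⟩ | ⟨h', -⟩ <;> rw [h, h'] <;> linarith
  have m1 : |b * d * (a + c)| + |a * c * (b + d)| ≤ etaL θ φ ω := le_max_left _ _
  have m2 : |b * d * (a - c)| + |a * c * (b - d)| ≤ etaL θ φ ω := le_max_right _ _
  have m0 : 0 ≤ etaL θ φ ω := le_trans (by positivity) m1
  have t1 := abs_add_le ((α₀ - α₁) / 2 * (b * d * (a + c))) ((α₀ + α₁) / 2 * (b * d * (a - c)))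
  have t2 := abs_add_le ((α₀ - α₁) / 2 * (a * c * (b + d))) ((α₀ + α₁) / 2 * (a * c * (b - d)))
  rw [abs_mul ((α₀ - α₁) / 2), abs_mul ((α₀ + α₁) / 2)] at t1 t2
  rw [e1, e2]
  nlinarith [mul_le_mul_of_nonneg_left m1 (abs_nonneg ((α₀ - α₁) / 2)),
    mul_le_mul_of_nonneg_left m2 (abs_nonneg ((α₀ + α₁) / 2)),
    mul_le_mul_of_nonneg_right huv m0]

theorem abs_bell_le_etaL {θ φ ω : ℝ} {p : Behaviour} (hp : IsLocal p) :
    |bell θ φ ω p| ≤ etaL θ φ ω := by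
  obtain ⟨Ω, _, μ, P, Q, hμ, hPm, hQm, hP0, hQ0, hP1, hQ1, hpe⟩ := hp
  have hPle : ∀ x a l, P x a l ≤ 1 := fun x a l =>
    (Finset.single_le_sum (fun i _ => hP0 x i l) (Finset.mem_univ a)).trans_eq (hP1 x l)
  have hQle : ∀ x a l, Q x a l ≤ 1 := fun x a l =>
    (Finset.single_le_sum (fun i _ => hQ0 x i l) (Finset.mem_univ a)).trans_eq (hQ1 x l)
  have hint : ∀ x a y b, Integrable (fun l => P x a l * Q y b l) μ := by
    intro x a y b
    refine Integrable.of_bound ((hPm x a).mul (hQm y b)).aestronglyMeasurable 1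
      (Filter.Eventually.of_forall fun l => ?_)
    rw [Real.norm_eq_abs, abs_of_nonneg (mul_nonneg (hP0 x a l) (hQ0 y b l))]
    exact mul_le_one₀ (hPle x a l) (hQ0 y b l) (hQle y b l)
  set α : Fin 2 → Ω → ℝ := fun x l => P x 0 l - P x 1 l with hα
  set β : Fin 2 → Ω → ℝ := fun y l => Q y 0 l - Q y 1 l with hβ
  have hαle : ∀ x l, |α x l| ≤ 1 := fun x l => by
    have := hP1 x l
    rw [Fin.sum_univ_two] at this
    rw [abs_le]
    constructor <;> linarith [hP0 x 0 l, hP0 x 1 l]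
  have hβle : ∀ x l, |β x l| ≤ 1 := fun x l => by
    have := hQ1 x l
    rw [Fin.sum_univ_two] at this
    rw [abs_le]
    constructor <;> linarith [hQ0 x 0 l, hQ0 x 1 l]
  have hαβ : ∀ x y, Integrable (fun l => α x l * β y l) μ := by
    intro x y
    have : (fun l => α x l * β y l) = fun l => P x 0 l * Q y 0 l - P x 0 l * Q y 1 l -
        P x 1 l * Q y 0 l + P x 1 l * Q y 1 l := by
      funext l; simp only [hα, hβ]; ring
    rw [this]
    exact (((hint _ _ _ _).sub (hint _ _ _ _)).sub (hint _ _ _ _)).add (hint _ _ _ _)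
  have hcorr : ∀ x y, corr p x y = ∫ l, α x l * β y l ∂μ := by
    intro x y
    have : (fun l => α x l * β y l) = fun l => P x 0 l * Q y 0 l - P x 0 l * Q y 1 l -
        P x 1 l * Q y 0 l + P x 1 l * Q y 1 l := by
      funext l; simp only [hα, hβ]; ring
    rw [this, integral_add, integral_sub, integral_sub]
    · simp only [corr, Fin.sum_univ_two, hpe]
      norm_num
      ring
    · exact hint _ _ _ _
    · exact hint _ _ _ _
    · exact (hint _ _ _ _).sub (hint _ _ _ _)
    · exact hint _ _ _ _
    · exact ((hint _ _ _ _).sub (hint _ _ _ _)).sub (hint _ _ _ _)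
    · exact hint _ _ _ _
  set F : Ω → ℝ := fun l =>
      Real.cos (θ + φ) * Real.cos (θ + ω) *
        (Real.cos ω * (α 0 l * β 0 l) - Real.cos φ * (α 0 l * β 1 l)) +
      Real.cos φ * Real.cos ω *
        (-Real.cos (θ + ω) * (α 1 l * β 0 l) + Real.cos (θ + φ) * (α 1 l * β 1 l)) with hF
  have hbell : bell θ φ ω p = ∫ l, F l ∂μ := by
    rw [bell, hcorr, hcorr, hcorr, hcorr, hF, integral_add, integral_const_mul,
      integral_const_mul, integral_sub, integral_add, integral_const_mul, integral_const_mul,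
      integral_const_mul, integral_const_mul]
    · exact (hαβ _ _).const_mul _
    · exact (hαβ _ _).const_mul _
    · exact (hαβ _ _).const_mul _
    · exact (hαβ _ _).const_mul _
    · exact (((hαβ _ _).const_mul _).sub ((hαβ _ _).const_mul _)).const_mul _
    · exact (((hαβ _ _).const_mul _).add ((hαβ _ _).const_mul _)).const_mul _
  have hFle : ∀ l, ‖F l‖ ≤ etaL θ φ ω := by
    intro l
    refine le_trans ?_ (abs_add_abs_le_etaL θ φ ω (hαle 0 l) (hαle 1 l))
    have e : F l = β 0 l * (Real.cos (θ + ω) * Real.cos ω *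
          (Real.cos (θ + φ) * α 0 l - Real.cos φ * α 1 l)) -
        β 1 l * (Real.cos (θ + φ) * Real.cos φ *
          (Real.cos (θ + ω) * α 0 l - Real.cos ω * α 1 l)) := by
      rw [hF]; ring
    rw [Real.norm_eq_abs, e]
    refine (abs_sub _ _).trans ?_
    rw [abs_mul (β 0 l), abs_mul (β 1 l)]
    exact add_le_add (mul_le_of_le_one_left (abs_nonneg _) (hβle 0 l))
      (mul_le_of_le_one_left (abs_nonneg _) (hβle 1 l))
  rw [hbell, ← Real.norm_eq_abs]
  simpa using norm_integral_le_of_norm_le_const (μ := μ) (Filter.Eventually.of_forall hFle)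

/-- Independent coins with means `α x` and `β y` form a local behaviour. -/
theorem exists_isLocal_corr_eq_mul {α β : Fin 2 → ℝ} (hα : ∀ x, |α x| ≤ 1)
    (hβ : ∀ y, |β y| ≤ 1) : ∃ p, IsLocal p ∧ ∀ x y, corr p x y = α x * β y := by
  have hpos : ∀ (γ : Fin 2 → ℝ), (∀ x, |γ x| ≤ 1) → ∀ x (a : Fin 2),
      0 ≤ (1 + (-1 : ℝ) ^ a.val * γ x) / 2 := by
    intro γ h x a
    have := abs_le.mp (h x)
    fin_cases a <;> norm_num <;> linarith
  refine ⟨fun a b x y => ((1 + (-1 : ℝ) ^ a.val * α x) / 2) * ((1 + (-1 : ℝ) ^ b.val * β y) / 2),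
    ⟨Unit, inferInstance, Measure.dirac (), fun x a _ => (1 + (-1 : ℝ) ^ a.val * α x) / 2,
      fun y b _ => (1 + (-1 : ℝ) ^ b.val * β y) / 2, inferInstance, fun _ _ => measurable_const,
      fun _ _ => measurable_const, fun x a _ => hpos α hα x a, fun y b _ => hpos β hβ y b,
      ?_, ?_, ?_⟩, ?_⟩
  · intro x _
    simp [Fin.sum_univ_two]
    ring
  · intro y _
    simp [Fin.sum_univ_two]
    ring
  · intro a b x y
    simp
  · intro x y
    simp [corr, Fin.sum_univ_two]
    ring

/-- Both signs of the local value are attained by deterministic strategies: the first party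
plays one of the two vertices up to sign, the second party matches the signs. -/
theorem exists_isLocal_bell_eq (θ φ ω : ℝ) {ε : ℝ} (hε : |ε| = 1) :
    ∃ p, IsLocal p ∧ bell θ φ ω p = ε * etaL θ φ ω := by
  have key : ∀ τ : ℝ, |τ| = 1 → ∃ p, IsLocal p ∧ bell θ φ ω p = ε *
      (|Real.cos (θ + ω) * Real.cos ω * (Real.cos (θ + φ) + τ * Real.cos φ)| +
      |Real.cos (θ + φ) * Real.cos φ * (Real.cos (θ + ω) + τ * Real.cos ω)|) := by
    intro τ hτ
    have hsgn : ∀ z : ℝ, ∃ β : ℝ, |β| ≤ 1 ∧ β * z = |z| := by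
      intro z
      rcases abs_cases z with ⟨h, -⟩ | ⟨h, -⟩
      · exact ⟨1, by simp, by rw [h, one_mul]⟩
      · exact ⟨-1, by simp, by rw [h, neg_one_mul]⟩
    obtain ⟨β₀, hb0, hb0'⟩ :=
      hsgn (Real.cos (θ + ω) * Real.cos ω * (Real.cos (θ + φ) + τ * Real.cos φ))
    obtain ⟨β₁, hb1, hb1'⟩ :=
      hsgn (Real.cos (θ + φ) * Real.cos φ * (Real.cos (θ + ω) + τ * Real.cos ω))
    obtain ⟨p, hp, hc⟩ := exists_isLocal_corr_eq_mul (α := ![ε, -(ε * τ)]) (β := ![β₀, -β₁])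
      (by simp [Fin.forall_fin_two, abs_mul, hε, hτ])
      (by simp [Fin.forall_fin_two, hb0, hb1])
    refine ⟨p, hp, ?_⟩
    rw [bell_eq_of_corr_eq_mul hc, ← hb0', ← hb1']
    simp only [Matrix.cons_val_zero, Matrix.cons_val_one]
    ring
  rcases max_choice
    (|Real.cos (θ + ω) * Real.cos ω * (Real.cos (θ + φ) + Real.cos φ)| +
      |Real.cos (θ + φ) * Real.cos φ * (Real.cos (θ + ω) + Real.cos ω)|)
    (|Real.cos (θ + ω) * Real.cos ω * (Real.cos (θ + φ) - Real.cos φ)| +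
      |Real.cos (θ + φ) * Real.cos φ * (Real.cos (θ + ω) - Real.cos ω)|) with h | h
  · rw [etaL, h]
    simpa using key 1 (by simp)
  · rw [etaL, h]
    simpa [sub_eq_add_neg] using key (-1) (by simp)

/-! ### Quantum strategies and the sum-of-squares decomposition -/

theorem sub_kronecker {l m n p : Type*} (A₁ A₂ : Matrix l m ℂ) (B : Matrix n p ℂ) :
    (A₁ - A₂) ⊗ₖ B = A₁ ⊗ₖ B - A₂ ⊗ₖ B := by
  ext; simp [sub_mul]

theorem kronecker_sub {l m n p : Type*} (A : Matrix l m ℂ) (B₁ B₂ : Matrix n p ℂ) :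
    A ⊗ₖ (B₁ - B₂) = A ⊗ₖ B₁ - A ⊗ₖ B₂ := by
  ext; simp [mul_sub]

namespace IsProjMeas

variable {d : ℕ} {M : Fin 2 → Matrix (Fin d) (Fin d) ℂ}

theorem isHermitian_sub (h : IsProjMeas M) : (M 0 - M 1).IsHermitian :=
  (h.herm 0).sub (h.herm 1)

theorem sub_mul_self (h : IsProjMeas M) : (M 0 - M 1) * (M 0 - M 1) = 1 := by
  have e : M 1 = 1 - M 0 := by
    rw [eq_sub_iff_add_eq, add_comm, ← Fin.sum_univ_two, h.sum_eq_one]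
  rw [e]
  simp only [mul_sub, sub_mul, h.idem 0, mul_one, one_mul]
  abel

end IsProjMeas

/-- The projective measurement with observable `A`. -/
noncomputable def spectralMeas {d : ℕ} (A : Matrix (Fin d) (Fin d) ℂ) (a : Fin 2) :
    Matrix (Fin d) (Fin d) ℂ :=
  (2⁻¹ : ℝ) • (1 + (-1 : ℝ) ^ a.val • A)

theorem isProjMeas_spectralMeas {d : ℕ} {A : Matrix (Fin d) (Fin d) ℂ} (h : A.IsHermitian)
    (h2 : A * A = 1) : IsProjMeas (spectralMeas A) where
  herm a := by
    have : Aᴴ = A := h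
    rw [Matrix.IsHermitian, spectralMeas, conjTranspose_smul, conjTranspose_add,
      conjTranspose_smul, this]
    simp
  idem a := by
    fin_cases a
    all_goals
      simp [spectralMeas, mul_add, add_mul, h2]
      module
  sum_eq_one := by
    rw [Fin.sum_univ_two]
    simp only [spectralMeas, Fin.val_zero, Fin.val_one, pow_zero, pow_one]
    module

theorem spectralMeas_zero_sub_one {d : ℕ} (A : Matrix (Fin d) (Fin d) ℂ) :
    spectralMeas A 0 - spectralMeas A 1 = A := by
  simp only [spectralMeas, Fin.val_zero, Fin.val_one, pow_zero, pow_one]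
  module

namespace QStrategy

variable {dA dB : ℕ} (S : QStrategy dA dB)

theorem corr_behaviour (x y : Fin 2) :
    corr S.behaviour x y = ((S.obsA x ⊗ₖ S.obsB y) * S.ρ).trace.re := by
  simp [corr, behaviour, obsA, obsB, Fin.sum_univ_two, sub_kronecker, kronecker_sub, sub_mul]
  ring

/-- Alice's observables as operators on the joint space. -/
def jointA (x : Fin 2) : Matrix (Fin dA × Fin dB) (Fin dA × Fin dB) ℂ := S.obsA x ⊗ₖ 1

/-- Bob's observables as operators on the joint space. -/
def jointB (y : Fin 2) : Matrix (Fin dA × Fin dB) (Fin dA × Fin dB) ℂ := 1 ⊗ₖ S.obsB y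

theorem obsA_mul_self (x : Fin 2) : S.obsA x * S.obsA x = 1 := (S.projM x).sub_mul_self

theorem obsB_mul_self (y : Fin 2) : S.obsB y * S.obsB y = 1 := (S.projN y).sub_mul_self

theorem isHermitian_obsA (x : Fin 2) : (S.obsA x).IsHermitian := (S.projM x).isHermitian_sub

theorem isHermitian_obsB (y : Fin 2) : (S.obsB y).IsHermitian := (S.projN y).isHermitian_sub

theorem jointA_mul_self (x : Fin 2) : S.jointA x * S.jointA x = 1 := by
  rw [jointA, ← mul_kronecker_mul, obsA_mul_self, one_mul, one_kronecker_one]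

theorem jointB_mul_self (y : Fin 2) : S.jointB y * S.jointB y = 1 := by
  rw [jointB, ← mul_kronecker_mul, obsB_mul_self, one_mul, one_kronecker_one]

theorem isHermitian_jointA (x : Fin 2) : (S.jointA x).IsHermitian := by
  rw [Matrix.IsHermitian, jointA, conjTranspose_kronecker, S.isHermitian_obsA, conjTranspose_one]

theorem isHermitian_jointB (y : Fin 2) : (S.jointB y).IsHermitian := by
  rw [Matrix.IsHermitian, jointB, conjTranspose_kronecker, S.isHermitian_obsB, conjTranspose_one]

theorem jointA_mul_jointB (x y : Fin 2) :
    S.jointA x * S.jointB y = S.obsA x ⊗ₖ S.obsB y := by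
  rw [jointA, jointB, ← mul_kronecker_mul, one_mul, mul_one]

theorem jointB_mul_jointA (x y : Fin 2) :
    S.jointB y * S.jointA x = S.jointA x * S.jointB y := by
  rw [jointA, jointB, ← mul_kronecker_mul, ← mul_kronecker_mul, one_mul, mul_one, one_mul, mul_one]

/-- The expectation value of an operator on the joint space. -/
noncomputable def expect : Matrix (Fin dA × Fin dB) (Fin dA × Fin dB) ℂ →ₗ[ℝ] ℝ where
  toFun C := (C * S.ρ).trace.re
  map_add' C D := by simp [add_mul]
  map_smul' r C := by simp

theorem expect_apply (C : Matrix (Fin dA × Fin dB) (Fin dA × Fin dB) ℂ) :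
    S.expect C = (C * S.ρ).trace.re := rfl

theorem expect_one : S.expect 1 = 1 := by
  rw [expect_apply, one_mul, S.trace_eq_one, Complex.one_re]

theorem expect_mul_self_nonneg {K : Matrix (Fin dA × Fin dB) (Fin dA × Fin dB) ℂ}
    (hK : K.IsHermitian) : 0 ≤ S.expect (K * K) := by
  have h := (S.posSemidef.mul_mul_conjTranspose_same K).trace_nonneg
  rw [hK.eq, trace_mul_cycle] at h
  exact (Complex.nonneg_iff.mp h).1

/-- An operator whose square has vanishing expectation annihilates every purification, here written
as a matrix `W` whose columns are indexed by a basis of the purifying space. -/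
theorem mul_eq_zero_of_expect_mul_self {K : Matrix (Fin dA × Fin dB) (Fin dA × Fin dB) ℂ}
    (hK : K.IsHermitian) (h0 : S.expect (K * K) = 0) {dE : ℕ}
    {W : Matrix (Fin dA × Fin dB) (Fin dE) ℂ} (hW : W * Wᴴ = S.ρ) : K * W = 0 := by
  have h := (S.posSemidef.mul_mul_conjTranspose_same K).trace_nonneg
  have e : (K * S.ρ * Kᴴ).trace = 0 := by
    refine Complex.ext ?_ ((Complex.nonneg_iff.mp h).2.symm)
    rw [hK.eq, trace_mul_cycle]
    exact h0
  rw [← trace_mul_conjTranspose_self_eq_zero_iff, ← e, ← hW, conjTranspose_mul]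
  simp only [Matrix.mul_assoc]

end QStrategy

/-- The square of `s A - (c B₁ - d B₀)` for `±1`-valued observables. -/
theorem square_smul_sub {R : Type*} [Ring R] [Algebra ℝ R] {A B₀ B₁ : R} (hA : A * A = 1)
    (hB₀ : B₀ * B₀ = 1) (hB₁ : B₁ * B₁ = 1) (h₀ : B₀ * A = A * B₀) (h₁ : B₁ * A = A * B₁)
    (s c d : ℝ) :
    (s • A - (c • B₁ - d • B₀)) * (s • A - (c • B₁ - d • B₀)) =
      (s ^ 2 + c ^ 2 + d ^ 2) • (1 : R) - (c * d) • (B₀ * B₁ + B₁ * B₀) -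
        (2 * s * c) • (A * B₁) + (2 * s * d) • (A * B₀) := by
  simp only [mul_sub, sub_mul, smul_mul_smul_comm, hA, hB₀, hB₁, h₀, h₁]
  module

namespace QStrategy

variable {dA dB : ℕ} (S : QStrategy dA dB)

/-- The operator whose kernel encodes the optimal relation between `A_0` and Bob's observables. The
sign `ε` selects the value `ε * η^Q`. -/
noncomputable def defect₀ (φ ω ε : ℝ) : Matrix (Fin dA × Fin dB) (Fin dA × Fin dB) ℂ :=
  (Real.sin (ω - φ) * ε) • S.jointA 0 - (Real.cos φ • S.jointB 1 - Real.cos ω • S.jointB 0)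

/-- The operator whose kernel encodes the optimal relation between `A_1` and Bob's observables. The
sign `ε` selects the value `ε * η^Q`. -/
noncomputable def defect₁ (θ φ ω ε : ℝ) : Matrix (Fin dA × Fin dB) (Fin dA × Fin dB) ℂ :=
  (Real.sin (ω - φ) * ε) • S.jointA 1 -
    (Real.cos (θ + φ) • S.jointB 1 - Real.cos (θ + ω) • S.jointB 0)

theorem isHermitian_real_smul {n : Type*} {M : Matrix n n ℂ} (h : M.IsHermitian) (r : ℝ) :
    (r • M).IsHermitian := by
  rw [Matrix.IsHermitian, conjTranspose_smul, h.eq, star_trivial]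

theorem isHermitian_defect₀ (φ ω ε : ℝ) : (S.defect₀ φ ω ε).IsHermitian :=
  (isHermitian_real_smul (S.isHermitian_jointA 0) _).sub
    ((isHermitian_real_smul (S.isHermitian_jointB 1) _).sub
      (isHermitian_real_smul (S.isHermitian_jointB 0) _))

theorem isHermitian_defect₁ (θ φ ω ε : ℝ) : (S.defect₁ θ φ ω ε).IsHermitian :=
  (isHermitian_real_smul (S.isHermitian_jointA 1) _).sub
    ((isHermitian_real_smul (S.isHermitian_jointB 1) _).sub
      (isHermitian_real_smul (S.isHermitian_jointB 0) _))

/-- The sum-of-squares decomposition of `η^Q - ε ⟨B⟩` for a sign `ε`: the anticommutators of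
Bob's observables cancel, and the constants add up by `sum_of_squares_constant`. -/
theorem sum_of_squares (θ φ ω : ℝ) {ε : ℝ} (hε : ε ^ 2 = 1) :
    Real.cos φ * Real.cos ω *
        S.expect (S.defect₁ θ φ ω ε * S.defect₁ θ φ ω ε) -
      Real.cos (θ + φ) * Real.cos (θ + ω) *
        S.expect (S.defect₀ φ ω ε * S.defect₀ φ ω ε) =
    2 * Real.sin (ω - φ) * (etaQ θ φ ω - ε * bell θ φ ω S.behaviour) := by
  have hc : ∀ x y, corr S.behaviour x y = S.expect (S.jointA x * S.jointB y) := by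
    intro x y
    rw [corr_behaviour, jointA_mul_jointB, expect_apply]
  rw [defect₀, defect₁,
    square_smul_sub (S.jointA_mul_self 0) (S.jointB_mul_self 0) (S.jointB_mul_self 1)
      (S.jointB_mul_jointA 0 0) (S.jointB_mul_jointA 0 1),
    square_smul_sub (S.jointA_mul_self 1) (S.jointB_mul_self 0) (S.jointB_mul_self 1)
      (S.jointB_mul_jointA 1 0) (S.jointB_mul_jointA 1 1), bell, etaQ_eq]
  simp only [map_add, map_sub, map_smul, smul_eq_mul, expect_one, hc]
  linear_combination sum_of_squares_constant θ φ ω +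
    Real.sin (ω - φ) ^ 2 * (Real.cos φ * Real.cos ω - Real.cos (θ + φ) * Real.cos (θ + ω)) * hε

variable {θ φ ω : ℝ}

/-- Under the sign condition the two squares enter the decomposition with the same sign. -/
theorem abs_bell_le_abs_etaQ
    (h : Real.cos (θ + φ) * Real.cos φ * Real.cos (θ + ω) * Real.cos ω < 0) :
    |bell θ φ ω S.behaviour| ≤ |etaQ θ φ ω| := by
  have hs := (sin_ne_zero_of_cos_prod_neg h).2
  have hp := S.sum_of_squares θ φ ω (ε := 1) (by norm_num)
  have hm := S.sum_of_squares θ φ ω (ε := -1) (by norm_num)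
  have p0 := S.expect_mul_self_nonneg (S.isHermitian_defect₀ φ ω 1)
  have p1 := S.expect_mul_self_nonneg (S.isHermitian_defect₁ θ φ ω 1)
  have m0 := S.expect_mul_self_nonneg (S.isHermitian_defect₀ φ ω (-1))
  have m1 := S.expect_mul_self_nonneg (S.isHermitian_defect₁ θ φ ω (-1))
  have hneg : Real.cos φ * Real.cos ω * (Real.cos (θ + φ) * Real.cos (θ + ω)) < 0 := by
    linarith
  have key : |Real.sin (ω - φ) * bell θ φ ω S.behaviour| ≤
      |Real.sin (ω - φ) * etaQ θ φ ω| := by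
    rcases mul_neg_iff.mp hneg with ⟨k1, k2⟩ | ⟨k1, k2⟩
    · have := mul_nonneg k1.le p1
      have := mul_nonneg k1.le m1
      have := mul_nonpos_of_nonpos_of_nonneg k2.le p0
      have := mul_nonpos_of_nonpos_of_nonneg k2.le m0
      refine le_trans ?_ (le_abs_self _)
      rw [abs_le]
      constructor <;> nlinarith
    · have := mul_nonneg k2.le p0
      have := mul_nonneg k2.le m0
      have := mul_nonpos_of_nonpos_of_nonneg k1.le p1
      have := mul_nonpos_of_nonpos_of_nonneg k1.le m1
      refine le_trans ?_ (neg_le_abs _)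
      rw [abs_le]
      constructor <;> nlinarith
  rw [abs_mul, abs_mul] at key
  exact le_of_mul_le_mul_left key (abs_pos.mpr hs)

/-- A strategy of value `η^Q` makes both squares in the decomposition vanish. -/
theorem defect_mul_eq_zero
    (h : Real.cos (θ + φ) * Real.cos φ * Real.cos (θ + ω) * Real.cos ω < 0)
    (hS : bell θ φ ω S.behaviour = etaQ θ φ ω) {dE : ℕ}
    {W : Matrix (Fin dA × Fin dB) (Fin dE) ℂ} (hW : W * Wᴴ = S.ρ) :
    S.defect₀ φ ω 1 * W = 0 ∧ S.defect₁ θ φ ω 1 * W = 0 := by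
  have hp := S.sum_of_squares θ φ ω (ε := 1) (by norm_num)
  have p0 := S.expect_mul_self_nonneg (S.isHermitian_defect₀ φ ω 1)
  have p1 := S.expect_mul_self_nonneg (S.isHermitian_defect₁ θ φ ω 1)
  have hneg : Real.cos φ * Real.cos ω * (Real.cos (θ + φ) * Real.cos (θ + ω)) < 0 := by
    linarith
  rw [hS, one_mul, sub_self, mul_zero] at hp
  have key : S.expect (S.defect₀ φ ω 1 * S.defect₀ φ ω 1) = 0 ∧
      S.expect (S.defect₁ θ φ ω 1 * S.defect₁ θ φ ω 1) = 0 := by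
    rcases mul_neg_iff.mp hneg with ⟨k1, k2⟩ | ⟨k1, k2⟩
    · have h1 := mul_nonneg k1.le p1
      have h0 := mul_nonpos_of_nonpos_of_nonneg k2.le p0
      exact ⟨(mul_eq_zero.mp (le_antisymm h0 (by linarith))).resolve_left k2.ne,
        (mul_eq_zero.mp (le_antisymm (by linarith) h1)).resolve_left k1.ne'⟩
    · have h1 := mul_nonneg k2.le p0
      have h0 := mul_nonpos_of_nonpos_of_nonneg k1.le p1
      exact ⟨(mul_eq_zero.mp (le_antisymm (by linarith) h1)).resolve_left k2.ne',
        (mul_eq_zero.mp (le_antisymm h0 (by linarith))).resolve_left k1.ne⟩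
  exact ⟨S.mul_eq_zero_of_expect_mul_self (S.isHermitian_defect₀ φ ω 1) key.1 hW,
    S.mul_eq_zero_of_expect_mul_self (S.isHermitian_defect₁ θ φ ω 1) key.2 hW⟩

end QStrategy

/-! ### The target strategy -/

theorem xyObs_eq (α : ℝ) : xyObs α = Real.cos α • pauliX + Real.sin α • pauliY := rfl

theorem xyObs_apply (α : ℝ) : xyObs α =
    !![0, (Real.cos α : ℂ) - Complex.I * Real.sin α;
      (Real.cos α : ℂ) + Complex.I * Real.sin α, 0] := by
  ext i j
  fin_cases i <;> fin_cases j <;> simp [xyObs, pauliX, pauliY] <;> ring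

theorem xyObs_zero : xyObs 0 = pauliX := by simp [xyObs_eq]

theorem isHermitian_xyObs (α : ℝ) : (xyObs α).IsHermitian := by
  ext i j
  fin_cases i <;> fin_cases j <;> simp [xyObs_apply, -Complex.ofReal_cos, -Complex.ofReal_sin] <;>
    ring

theorem xyObs_mul_self (α : ℝ) : xyObs α * xyObs α = 1 := by
  have h : (Real.sin α : ℂ) ^ 2 + (Real.cos α : ℂ) ^ 2 = 1 := by
    exact_mod_cast Real.sin_sq_add_cos_sq α
  ext i j
  fin_cases i <;> fin_cases j <;>
    simp [xyObs_apply, Matrix.mul_apply, Fin.sum_univ_two, -Complex.ofReal_cos,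
      -Complex.ofReal_sin] <;>
    linear_combination h - Real.sin α ^ 2 * Complex.I_sq

theorem targetA_eq (θ : ℝ) (x : Fin 2) : targetA θ x = xyObs (![0, θ] x) := by
  fin_cases x <;> simp [targetA, xyObs_zero]

theorem targetB_eq (φ ω : ℝ) (y : Fin 2) : targetB φ ω y = xyObs (![φ, ω] y) := by
  fin_cases y <;> simp [targetB]

theorem inv_sqrt_two_mul_self :
    ((Real.sqrt 2 : ℝ) : ℂ)⁻¹ * ((Real.sqrt 2 : ℝ) : ℂ)⁻¹ = 2⁻¹ := by
  rw [← mul_inv]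
  norm_cast
  rw [Real.mul_self_sqrt (by norm_num)]
  norm_num

/-- The strategy that measures `cos α σ_X + sin α σ_Y` for angles `α x` and `β y` on the
target state. -/
noncomputable def planarStrategy (α β : Fin 2 → ℝ) : QStrategy 2 2 where
  ρ := Matrix.vecMulVec targetState (star targetState)
  M x := spectralMeas (xyObs (α x))
  N y := spectralMeas (xyObs (β y))
  posSemidef := Matrix.posSemidef_vecMulVec_self_star _
  trace_eq_one := by
    simp [Matrix.trace, Matrix.vecMulVec_apply, Fintype.sum_prod_type, Fin.sum_univ_two,
      targetState]
    linear_combination (1 - Complex.I ^ 2) * inv_sqrt_two_mul_self - 2⁻¹ * Complex.I_sq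
  projM x := isProjMeas_spectralMeas (isHermitian_xyObs _) (xyObs_mul_self _)
  projN y := isProjMeas_spectralMeas (isHermitian_xyObs _) (xyObs_mul_self _)

theorem obsA_planarStrategy (α β : Fin 2 → ℝ) (x : Fin 2) :
    (planarStrategy α β).obsA x = xyObs (α x) := spectralMeas_zero_sub_one _

theorem obsB_planarStrategy (α β : Fin 2 → ℝ) (y : Fin 2) :
    (planarStrategy α β).obsB y = xyObs (β y) := spectralMeas_zero_sub_one _

theorem corr_planarStrategy (α β : Fin 2 → ℝ) (x y : Fin 2) :
    corr (planarStrategy α β).behaviour x y = Real.sin (α x + β y) := by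
  rw [QStrategy.corr_behaviour, obsA_planarStrategy, obsB_planarStrategy]
  have : ((xyObs (α x) ⊗ₖ xyObs (β y)) * (planarStrategy α β).ρ).trace =
      ((Real.sin (α x + β y) : ℝ) : ℂ) := by
    simp [planarStrategy, Matrix.trace, Matrix.mul_apply, Matrix.vecMulVec_apply,
      Fintype.sum_prod_type, Fin.sum_univ_two, targetState, xyObs_apply, Real.sin_add,
      -Complex.ofReal_cos, -Complex.ofReal_sin, -Complex.ofReal_add]
    rw [Complex.ofReal_add, Complex.ofReal_mul, Complex.ofReal_mul]
    linear_combination (-2 * Complex.I ^ 2 * (Real.sin (α x) * Real.cos (β y) +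
      Real.cos (α x) * Real.sin (β y))) * inv_sqrt_two_mul_self -
      (Real.sin (α x) * Real.cos (β y) + Real.cos (α x) * Real.sin (β y)) * Complex.I_sq
  rw [this, Complex.ofReal_re]

theorem bell_planarStrategy (θ φ ω : ℝ) :
    bell θ φ ω (planarStrategy ![0, θ] ![φ, ω]).behaviour = etaQ θ φ ω := by
  simp only [bell, corr_planarStrategy, etaQ_eq, Matrix.cons_val_zero, Matrix.cons_val_one,
    zero_add]
  have e := Real.sin_sub (θ + ω) (θ + φ)
  rw [show θ + ω - (θ + φ) = ω - φ by ring] at e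
  linear_combination (Real.cos (θ + φ) * Real.cos (θ + ω)) * Real.sin_sub ω φ -
    Real.cos φ * Real.cos ω * e

/-- Turning Alice's measurements by `π` flips the sign of the Bell expression. -/
theorem bell_planarStrategy_add_pi (θ φ ω : ℝ) :
    bell θ φ ω (planarStrategy ![Real.pi, θ + Real.pi] ![φ, ω]).behaviour =
      -etaQ θ φ ω := by
  rw [← bell_planarStrategy]
  have h : ∀ z, Real.sin (Real.pi + z) = -Real.sin z := fun z => by
    rw [add_comm, Real.sin_add_pi]
  have h' : ∀ z, Real.sin (θ + Real.pi + z) = -Real.sin (θ + z) := fun z => by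
    rw [show θ + Real.pi + z = θ + z + Real.pi by ring, Real.sin_add_pi]
  simp only [bell, corr_planarStrategy, Matrix.cons_val_zero, Matrix.cons_val_one, zero_add, h, h']
  ring

/-! ### Extraction of a qubit -/

/-- The orthogonal projection `P` onto the `μ`-eigenspace of a Hermitian matrix `T`. The matrix `G`
is the inverse of `T - μ` on the orthogonal complement. -/
theorem exists_eigenprojection {d : ℕ} {T : Matrix (Fin d) (Fin d) ℂ} (hT : T.IsHermitian)
    (μ : ℝ) : ∃ P G : Matrix (Fin d) (Fin d) ℂ, P.IsHermitian ∧ P * P = P ∧ T * P = μ • P ∧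
      P = 1 - G * (T - μ • 1) ∧ ∀ C, Commute T C → Commute P C := by
  have hT' : IsSelfAdjoint T := hT
  have hc : ∀ f : ℝ → ℝ, ContinuousOn f (spectrum ℝ T) := fun f =>
    (Matrix.finite_real_spectrum (A := T)).continuousOn f
  set f : ℝ → ℝ := fun x => if x = μ then 1 else 0 with hf
  set g : ℝ → ℝ := fun x => if x = μ then 0 else (x - μ)⁻¹ with hg
  refine ⟨cfc f T, cfc g T, cfc_predicate f T, ?_, ?_, ?_, ?_⟩
  · rw [← cfc_mul f f T (hc _) (hc _)]
    congr 1
    funext x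
    by_cases h : x = μ <;> simp [hf, h]
  · have e : T * cfc f T = cfc (fun x => x * f x) T := by
      rw [cfc_mul (fun x => x) f T (hc _) (hc _), cfc_id' ℝ T]
    rw [e, ← cfc_smul μ f T (hc _)]
    congr 1
    funext x
    by_cases h : x = μ <;> simp [hf, h]
  · have e : T - μ • 1 = cfc (fun x => x - μ) T := by
      rw [cfc_sub (fun x => x) (fun _ => μ) T (hc _) (hc _), cfc_id' ℝ T, cfc_const μ T,
        Algebra.algebraMap_eq_smul_one]
    rw [e, ← cfc_mul g _ T (hc _) (hc _), ← cfc_const_one ℝ T, ← cfc_sub _ _ T (hc _) (hc _)]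
    congr 1
    funext x
    by_cases h : x = μ
    · simp [hf, h]
    · simp [hf, hg, h, sub_ne_zero.mpr h]
  · intro C hC
    exact hT'.commute_cfc hC f

/-- The map `v ↦ |0⟩ ⊗ V₀ v + |1⟩ ⊗ V₁ v`. -/
def stack {d k : ℕ} (V₀ V₁ : Matrix (Fin d) (Fin k) ℂ) : Matrix (Fin 2 × Fin d) (Fin k) ℂ :=
  Matrix.of fun i t => ![V₀, V₁] i.1 i.2 t

theorem stack_mul {d k l : ℕ} (V₀ V₁ : Matrix (Fin d) (Fin k) ℂ) (M : Matrix (Fin k) (Fin l) ℂ) :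
    stack V₀ V₁ * M = stack (V₀ * M) (V₁ * M) := by
  ext ⟨i, s⟩ t
  fin_cases i <;> simp [stack, Matrix.mul_apply]

theorem conjTranspose_stack_mul_stack {d k : ℕ} (V₀ V₁ : Matrix (Fin d) (Fin k) ℂ) :
    (stack V₀ V₁)ᴴ * stack V₀ V₁ = V₀ᴴ * V₀ + V₁ᴴ * V₁ := by
  ext s t
  simp [stack, Matrix.mul_apply, Fintype.sum_prod_type, Fin.sum_univ_two]

theorem pauliX_kronecker_mul_stack {d k : ℕ} (V₀ V₁ : Matrix (Fin d) (Fin k) ℂ) :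
    (pauliX ⊗ₖ (1 : Matrix (Fin d) (Fin d) ℂ)) * stack V₀ V₁ = stack V₁ V₀ := by
  ext ⟨i, s⟩ t
  fin_cases i <;> simp [stack, pauliX, Matrix.mul_apply, Fintype.sum_prod_type, Fin.sum_univ_two,
    Matrix.one_apply]

theorem pauliY_kronecker_mul_stack {d k : ℕ} (V₀ V₁ : Matrix (Fin d) (Fin k) ℂ) :
    (pauliY ⊗ₖ (1 : Matrix (Fin d) (Fin d) ℂ)) * stack V₀ V₁ =
      stack (-Complex.I • V₁) (Complex.I • V₀) := by
  ext ⟨i, s⟩ t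
  fin_cases i <;> simp [stack, pauliY, Matrix.mul_apply, Fintype.sum_prod_type, Fin.sum_univ_two,
    Matrix.one_apply]

/-- A pair of anticommuting observables on the range of a projection `P` is carried to the Pauli
matrices `σ_X`, `σ_Y` by an isometry that is defined on the whole space. On the range of `P` it is
the swap isometry `v ↦ |0⟩ ⊗ (1 + Z)/2 v + |1⟩ ⊗ X (1 - Z)/2 v` with `Z = -i X Y`; the
complement is mapped to `|0⟩ ⊗ v`. -/
theorem exists_isometry_of_anticommute {d : ℕ} {X Y P : Matrix (Fin d) (Fin d) ℂ}
    (hX : Xᴴ = X) (hY : Yᴴ = Y) (hP : Pᴴ = P) (hPP : P * P = P) (hXX : X * X = P)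
    (hYY : Y * Y = P) (hYX : Y * X = -(X * Y)) (hPX : P * X = X) (hXP : X * P = X)
    (hPY : P * Y = Y) (hYP : Y * P = Y) :
    ∃ V : Matrix (Fin 2 × Fin d) (Fin d) ℂ, Vᴴ * V = 1 ∧
      V * X = (pauliX ⊗ₖ (1 : Matrix (Fin d) (Fin d) ℂ)) * (V * P) ∧
      V * Y = (pauliY ⊗ₖ (1 : Matrix (Fin d) (Fin d) ℂ)) * (V * P) := by
  have hXXY : X * (X * Y) = Y := by rw [← mul_assoc, hXX, hPY]
  have hPXY : P * (X * Y) = X * Y := by rw [← mul_assoc, hPX]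
  have hYXY : Y * (X * Y) = -X := by rw [← mul_assoc, hYX, neg_mul, mul_assoc, hYY, hXP]
  have hII := Complex.I_sq
  set V₀ : Matrix (Fin d) (Fin d) ℂ := (2⁻¹ : ℂ) • (P - Complex.I • (X * Y)) + (1 - P) with hV₀
  set V₁ : Matrix (Fin d) (Fin d) ℂ := (2⁻¹ : ℂ) • (X + Complex.I • Y) with hV₁
  have hV₀' : V₀ᴴ = V₀ := by
    rw [hV₀]
    simp only [conjTranspose_add, conjTranspose_sub, conjTranspose_smul, conjTranspose_mul,
      conjTranspose_one, hX, hY, hP, hYX]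
    simp
  have hV₁' : V₁ᴴ = (2⁻¹ : ℂ) • (X - Complex.I • Y) := by
    rw [hV₁]
    simp only [conjTranspose_add, conjTranspose_smul, hX, hY]
    simp [sub_eq_add_neg]
  refine ⟨stack V₀ V₁, ?_, ?_, ?_⟩
  · rw [conjTranspose_stack_mul_stack, hV₀', hV₁', hV₀, hV₁]
    simp only [mul_add, add_mul, mul_sub, sub_mul, smul_mul_assoc, mul_smul_comm, mul_assoc, hXX,
      hYY, hYX, hPP, hPXY, hYXY, hYP, mul_neg, mul_one, one_mul, smul_sub, smul_add, smul_neg,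
      smul_smul]
    match_scalars <;> ring_nf <;> simp [hII]
  · rw [stack_mul, stack_mul, pauliX_kronecker_mul_stack]
    congr 1
    · rw [hV₀, hV₁]
      simp only [add_mul, sub_mul, smul_mul_assoc, mul_assoc, hYX, hPX, hXP, hYP, hXXY, one_mul,
        mul_neg]
      module
    · rw [hV₀, hV₁]
      simp only [add_mul, sub_mul, smul_mul_assoc, mul_assoc, hYX, hXX, hPP, hYP, one_mul]
      module
  · rw [stack_mul, stack_mul, pauliY_kronecker_mul_stack]
    congr 1
    · rw [hV₀, hV₁]
      simp only [add_mul, sub_mul, smul_mul_assoc, mul_assoc, hYY, hPY, hXP, hYP, one_mul]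
      match_scalars <;> ring_nf <;> simp [hII] <;> norm_num
    · rw [hV₀, hV₁]
      simp only [add_mul, sub_mul, smul_mul_assoc, mul_assoc, hYY, hPP, hYP, one_mul]
      match_scalars <;> ring_nf <;> simp [hII] <;> norm_num

/-- An isometry that extracts a qubit from a pair of `±1`-valued observables. It intertwines them
with the target observables on the eigenspace where the anticommutator has its ideal value. -/
theorem exists_isometry_intertwining {d : ℕ} {O : Fin 2 → Matrix (Fin d) (Fin d) ℂ}
    (hO : ∀ x, (O x).IsHermitian) (hO2 : ∀ x, O x * O x = 1) {α : Fin 2 → ℝ}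
    (hs : Real.sin (α 1 - α 0) ≠ 0) :
    ∃ (V : Matrix (Fin 2 × Fin d) (Fin d) ℂ) (P G : Matrix (Fin d) (Fin d) ℂ), Vᴴ * V = 1 ∧
      P = 1 - G * (O 0 * O 1 + O 1 * O 0 - (2 * Real.cos (α 1 - α 0)) • 1) ∧
      ∀ x, V * (O x * P) =
        (xyObs (α x) ⊗ₖ (1 : Matrix (Fin d) (Fin d) ℂ)) * (V * P) := by
  set T := O 0 * O 1 + O 1 * O 0 with hT
  have hTh : T.IsHermitian := by
    rw [Matrix.IsHermitian, hT, conjTranspose_add, conjTranspose_mul, conjTranspose_mul,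
      (hO 0).eq, (hO 1).eq, add_comm]
  obtain ⟨P, G, hP, hPP, hTP, hPG, hcomm⟩ :=
    exists_eigenprojection hTh (2 * Real.cos (α 1 - α 0))
  have c0 : P * O 0 = O 0 * P := by
    refine hcomm _ ?_
    rw [Commute, SemiconjBy, hT, add_mul, mul_add, mul_assoc (O 1), hO2, ← mul_assoc (O 0) (O 0),
      hO2, mul_assoc, mul_one, one_mul, add_comm]
  have c1 : P * O 1 = O 1 * P := by
    refine hcomm _ ?_
    rw [Commute, SemiconjBy, hT, add_mul, mul_add, mul_assoc (O 0), hO2, ← mul_assoc (O 1) (O 1),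
      hO2, mul_assoc, mul_one, one_mul, add_comm]
  set s := Real.sin (α 1 - α 0) with hsdef
  -- The combinations with `O x = cos (α x) D + sin (α x) E`, which play `σ_X` and `σ_Y`.
  set D : Matrix (Fin d) (Fin d) ℂ :=
    s⁻¹ • (Real.sin (α 1) • O 0 - Real.sin (α 0) • O 1) with hD
  set E : Matrix (Fin d) (Fin d) ℂ :=
    s⁻¹ • (Real.cos (α 0) • O 1 - Real.cos (α 1) • O 0) with hE
  have hDh : Dᴴ = D := by
    rw [hD]
    simp only [conjTranspose_smul, conjTranspose_sub, (hO _).eq, star_trivial]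
  have hEh : Eᴴ = E := by
    rw [hE]
    simp only [conjTranspose_smul, conjTranspose_sub, (hO _).eq, star_trivial]
  have hPD : P * D = D * P := by
    rw [hD]
    simp only [mul_smul_comm, smul_mul_assoc, mul_sub, sub_mul, c0, c1]
  have hPE : P * E = E * P := by
    rw [hE]
    simp only [mul_smul_comm, smul_mul_assoc, mul_sub, sub_mul, c0, c1]
  have hss : s * s⁻¹ = 1 := mul_inv_cancel₀ hs
  have hs2 : s = Real.sin (α 1) * Real.cos (α 0) - Real.cos (α 1) * Real.sin (α 0) :=
    Real.sin_sub _ _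
  have n0 := Real.sin_sq_add_cos_sq (α 0)
  have n1 := Real.sin_sq_add_cos_sq (α 1)
  have k2 := sin_sub_sq (α 0) (α 1)
  have k1 : s ^ 2 = Real.sin (α 0) ^ 2 + Real.sin (α 1) ^ 2 -
      2 * (Real.sin (α 0) * Real.sin (α 1)) * Real.cos (α 1 - α 0) := by
    rw [hs2, Real.cos_sub]
    linear_combination Real.sin (α 1) ^ 2 * n0 + Real.sin (α 0) ^ 2 * n1
  have k3 : 2 * Real.cos (α 1 - α 0) *
      (Real.sin (α 1) * Real.cos (α 0) + Real.sin (α 0) * Real.cos (α 1)) =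
      2 * Real.sin (α 0) * Real.cos (α 0) + 2 * Real.sin (α 1) * Real.cos (α 1) := by
    rw [Real.cos_sub]
    linear_combination (2 * Real.sin (α 1) * Real.cos (α 1)) * n0 +
      2 * Real.sin (α 0) * Real.cos (α 0) * n1
  rw [← hsdef] at k2
  have hTP' : O 0 * (O 1 * P) + O 1 * (O 0 * P) = (2 * Real.cos (α 1 - α 0)) • P := by
    rw [← hTP, hT, add_mul, mul_assoc, mul_assoc]
  have hTP'' : O 1 * (O 0 * P) = (2 * Real.cos (α 1 - α 0)) • P - O 0 * (O 1 * P) := by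
    rw [← hTP', add_sub_cancel_left]
  have h00 : O 0 * (O 0 * P) = P := by rw [← mul_assoc, hO2, one_mul]
  have h11 : O 1 * (O 1 * P) = P := by rw [← mul_assoc, hO2, one_mul]
  have hDD : D * (D * P) = P := by
    rw [hD]
    simp only [smul_mul_assoc, mul_smul_comm, mul_sub, sub_mul, hTP'', h00, h11]
    match_scalars
    · linear_combination -(s⁻¹) ^ 2 * k1 + (s * s⁻¹ + 1) * hss
    · ring
  have hEE : E * (E * P) = P := by
    rw [hE]
    simp only [smul_mul_assoc, mul_smul_comm, mul_sub, sub_mul, hTP'', h00, h11]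
    match_scalars
    · linear_combination -(s⁻¹) ^ 2 * k2 + (s * s⁻¹ + 1) * hss
    · ring
  have hDE : E * (D * P) = -(D * (E * P)) := by
    rw [hD, hE]
    simp only [smul_mul_assoc, mul_smul_comm, mul_sub, sub_mul, hTP'', h00, h11]
    match_scalars
    · linear_combination (s⁻¹) ^ 2 * k3
    · ring
  have hP' : ∀ M : Matrix (Fin d) (Fin d) ℂ, P * M = M * P → M * P * P = M * P ∧
      P * (M * P) = M * P := fun M hM =>
    ⟨by rw [mul_assoc, hPP], by rw [← mul_assoc, hM, mul_assoc, hPP]⟩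
  obtain ⟨V, hV, hVX, hVY⟩ := exists_isometry_of_anticommute (X := D * P) (Y := E * P) (P := P)
    (by rw [conjTranspose_mul, hDh, hP.eq, hPD]) (by rw [conjTranspose_mul, hEh, hP.eq, hPE])
    hP.eq hPP (by rw [mul_assoc, (hP' D hPD).2, hDD]) (by rw [mul_assoc, (hP' E hPE).2, hEE])
    (by rw [mul_assoc, (hP' D hPD).2, hDE, mul_assoc, (hP' E hPE).2])
    (hP' D hPD).2 (hP' D hPD).1 (hP' E hPE).2 (hP' E hPE).1
  have hOx : ∀ x, O x = Real.cos (α x) • D + Real.sin (α x) • E := by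
    intro x
    rw [hD, hE]
    fin_cases x
    · simp only [Fin.zero_eta]
      match_scalars
      · linear_combination -hss + s⁻¹ * hs2
      · ring
    · simp only [Fin.mk_one]
      match_scalars
      · linear_combination -hss + s⁻¹ * hs2
      · ring
  refine ⟨V, P, G, hV, hPG, fun x => ?_⟩
  rw [hOx, xyObs_eq, add_kronecker, smul_kronecker, smul_kronecker]
  simp only [Matrix.add_mul, Matrix.mul_add, Matrix.smul_mul, Matrix.mul_smul, hVX, hVY]

/-- Optimal correlations between one observable of one party and two observables of the other
fix the anticommutator of the latter. -/
theorem anticommutator_mul {n m : Type*} [Fintype n] [DecidableEq n] {A B₀ B₁ : Matrix n n ℂ}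
    (hA : A * A = 1) (hB₀ : B₀ * B₀ = 1) (hB₁ : B₁ * B₁ = 1) (h₀ : B₀ * A = A * B₀)
    (h₁ : B₁ * A = A * B₁) {s c d κ : ℝ} (hs : s ^ 2 = d ^ 2 + c ^ 2 - 2 * (d * c) * κ)
    (hcd : d * c ≠ 0) {W : Matrix n m ℂ} (hW : s • (A * W) = (c • B₁ - d • B₀) * W) :
    (B₀ * B₁ + B₁ * B₀) * W = (2 * κ) • W := by
  -- The combination of `B₀`, `B₁` commutes with `A`, so it acts twice as `s A` does.
  have e1 : (c • B₁ - d • B₀) * ((c • B₁ - d • B₀) * W) = s ^ 2 • W := by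
    have hc : (c • B₁ - d • B₀) * A = A * (c • B₁ - d • B₀) := by
      simp only [sub_mul, mul_sub, smul_mul_assoc, mul_smul_comm, h₀, h₁]
    rw [← hW, Matrix.mul_smul, ← Matrix.mul_assoc, hc, Matrix.mul_assoc, ← hW, Matrix.mul_smul,
      ← Matrix.mul_assoc, hA, Matrix.one_mul, smul_smul, sq]
  have e2 : (c • B₁ - d • B₀) * (c • B₁ - d • B₀) =
      (c ^ 2 + d ^ 2) • (1 : Matrix n n ℂ) - (d * c) • (B₀ * B₁ + B₁ * B₀) := by
    simp only [mul_sub, sub_mul, smul_mul_smul_comm, hB₀, hB₁]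
    module
  rw [← Matrix.mul_assoc, e2, Matrix.sub_mul, Matrix.smul_mul, Matrix.smul_mul, Matrix.one_mul,
    hs] at e1
  have e3 : (d * c) • ((B₀ * B₁ + B₁ * B₀) * W) = (d * c) • ((2 * κ) • W) := by
    rw [sub_eq_iff_eq_add] at e1
    rw [← sub_eq_iff_eq_add'] at e1
    rw [← e1]
    module
  exact smul_right_injective _ hcd e3

/-! ### Self-testing -/

/-- A vector of `E ⊗ H`, written as a matrix whose columns are indexed by the basis of `E`. -/
def reshape {E H : Type*} (Ψ : E × H → ℂ) : Matrix H E ℂ := Matrix.of fun k e => Ψ (e, k)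

theorem one_kronecker_mulVec_apply {E H K : Type*} [Fintype E] [DecidableEq E] [Fintype H]
    (C : Matrix K H ℂ) (Ψ : E × H → ℂ) (e : E) (k : K) :
    (((1 : Matrix E E ℂ) ⊗ₖ C) *ᵥ Ψ) (e, k) = (C * reshape Ψ) k e := by
  simp [Matrix.mulVec, dotProduct, Fintype.sum_prod_type, Matrix.mul_apply, reshape,
    Matrix.one_apply, Finset.sum_ite_irrel]

theorem reshape_one_kronecker_mulVec {E H K : Type*} [Fintype E] [DecidableEq E] [Fintype H]
    (C : Matrix K H ℂ) (Ψ : E × H → ℂ) :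
    reshape (((1 : Matrix E E ℂ) ⊗ₖ C) *ᵥ Ψ) = C * reshape Ψ := by
  ext k e
  exact one_kronecker_mulVec_apply C Ψ e k

theorem reshape_mul_conjTranspose {dE dA dB : ℕ} {Ψ : Fin dE × Fin dA × Fin dB → ℂ}
    {ρ : Matrix (Fin dA × Fin dB) (Fin dA × Fin dB) ℂ} (h : IsPurification Ψ ρ) :
    reshape Ψ * (reshape Ψ)ᴴ = ρ := by
  ext i j
  rw [← h i j]
  simp [reshape, Matrix.mul_apply]

/-- Operators on the two qubits act on the qubit indices only. -/
theorem qubit_kronecker_mul_apply {kA kB : ℕ} {E : Type*} (T U : Matrix (Fin 2) (Fin 2) ℂ)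
    (Φ : Matrix ((Fin 2 × Fin kA) × (Fin 2 × Fin kB)) E ℂ) (i j : Fin 2) (s : Fin kA)
    (t : Fin kB) (e : E) :
    (((T ⊗ₖ (1 : Matrix (Fin kA) (Fin kA) ℂ)) ⊗ₖ (U ⊗ₖ (1 : Matrix (Fin kB) (Fin kB) ℂ))) * Φ)
      ((i, s), (j, t)) e = ∑ i', ∑ j', T i i' * U j j' * Φ ((i', s), (j', t)) e := by
  simp only [Matrix.mul_apply, Fintype.sum_prod_type, kroneckerMap_apply, Matrix.one_apply]
  simp [Finset.sum_ite_irrel, ite_mul]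

namespace QStrategy

variable {dA dB dE : ℕ} (S : QStrategy dA dB) {θ φ ω : ℝ}
  {W : Matrix (Fin dA × Fin dB) (Fin dE) ℂ}

theorem smul_jointA_zero_mul (h0 : S.defect₀ φ ω 1 * W = 0) :
    Real.sin (ω - φ) • (S.jointA 0 * W) =
      (Real.cos φ • S.jointB 1 - Real.cos ω • S.jointB 0) * W := by
  rw [defect₀, Matrix.sub_mul, Matrix.smul_mul, mul_one] at h0
  exact sub_eq_zero.mp h0

theorem smul_jointA_one_mul (h1 : S.defect₁ θ φ ω 1 * W = 0) :
    Real.sin (ω - φ) • (S.jointA 1 * W) =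
      (Real.cos (θ + φ) • S.jointB 1 - Real.cos (θ + ω) • S.jointB 0) * W := by
  rw [defect₁, Matrix.sub_mul, Matrix.smul_mul, mul_one] at h1
  exact sub_eq_zero.mp h1

theorem anticommutator_jointB_mul (h0 : S.defect₀ φ ω 1 * W = 0)
    (hcd : Real.cos φ * Real.cos ω ≠ 0) :
    (S.jointB 0 * S.jointB 1 + S.jointB 1 * S.jointB 0) * W =
      (2 * Real.cos (ω - φ)) • W := by
  refine anticommutator_mul (S.jointA_mul_self 0) (S.jointB_mul_self 0) (S.jointB_mul_self 1)
    (S.jointB_mul_jointA 0 0) (S.jointB_mul_jointA 0 1) ?_ (by rwa [mul_comm])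
    (S.smul_jointA_zero_mul h0)
  rw [sin_sub_sq]
  ring

/-- Inverting the two optimality relations expresses `B_0` through Alice's observables. -/
theorem smul_jointB_zero_mul (h0 : S.defect₀ φ ω 1 * W = 0) (h1 : S.defect₁ θ φ ω 1 * W = 0)
    (hs : Real.sin (ω - φ) ≠ 0) :
    Real.sin θ • (S.jointB 0 * W) =
      (Real.cos φ • S.jointA 1 - Real.cos (θ + φ) • S.jointA 0) * W := by
  have e0 := S.smul_jointA_zero_mul h0
  have e1 := S.smul_jointA_one_mul h1
  have e : Real.sin (ω - φ) • (Real.sin θ • (S.jointB 0 * W)) = Real.sin (ω - φ) •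
      ((Real.cos φ • S.jointA 1 - Real.cos (θ + φ) • S.jointA 0) * W) := by
    rw [Matrix.sub_mul, Matrix.smul_mul, Matrix.smul_mul] at e0 e1 ⊢
    rw [smul_sub, smul_comm _ (Real.cos φ), smul_comm _ (Real.cos (θ + φ)), e0, e1, smul_smul,
      mul_comm, ← cos_mul_cos_sub_cos_mul_cos]
    module
  exact smul_right_injective _ hs e

theorem anticommutator_jointA_mul (h0 : S.defect₀ φ ω 1 * W = 0)
    (h1 : S.defect₁ θ φ ω 1 * W = 0) (hs : Real.sin (ω - φ) ≠ 0)
    (hac : Real.cos (θ + φ) * Real.cos φ ≠ 0) :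
    (S.jointA 0 * S.jointA 1 + S.jointA 1 * S.jointA 0) * W = (2 * Real.cos θ) • W := by
  refine anticommutator_mul (S.jointB_mul_self 0) (S.jointA_mul_self 0) (S.jointA_mul_self 1)
    (S.jointB_mul_jointA 0 0).symm (S.jointB_mul_jointA 1 0).symm ?_ hac
    (S.smul_jointB_zero_mul h0 h1 hs)
  have e := sin_sub_sq φ (θ + φ)
  rw [add_sub_cancel_right] at e
  rw [e]
  ring

/-- If the anticommutator of Alice's observables has the value `κ` on the state, then the
projection onto the `κ`-eigenspace of this anticommutator fixes the state. -/
theorem kronecker_one_mul_eq_self {P G : Matrix (Fin dA) (Fin dA) ℂ} {κ : ℝ}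
    (hP : P = 1 - G * (S.obsA 0 * S.obsA 1 + S.obsA 1 * S.obsA 0 - κ • 1))
    (hW : (S.jointA 0 * S.jointA 1 + S.jointA 1 * S.jointA 0) * W = κ • W) :
    (P ⊗ₖ (1 : Matrix (Fin dB) (Fin dB) ℂ)) * W = W := by
  have e : (S.obsA 0 * S.obsA 1 + S.obsA 1 * S.obsA 0 - κ • 1) ⊗ₖ
      (1 : Matrix (Fin dB) (Fin dB) ℂ) =
      S.jointA 0 * S.jointA 1 + S.jointA 1 * S.jointA 0 - κ • 1 := by
    simp only [jointA, ← mul_kronecker_mul, mul_one, sub_kronecker, add_kronecker, smul_kronecker,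
      one_kronecker_one]
  have e' : (G * (S.obsA 0 * S.obsA 1 + S.obsA 1 * S.obsA 0 - κ • 1)) ⊗ₖ
      (1 : Matrix (Fin dB) (Fin dB) ℂ) =
      (G ⊗ₖ 1) * (S.jointA 0 * S.jointA 1 + S.jointA 1 * S.jointA 0 - κ • 1) := by
    rw [← e, ← mul_kronecker_mul, mul_one]
  rw [hP, sub_kronecker, one_kronecker_one, e', Matrix.sub_mul, Matrix.mul_assoc, Matrix.sub_mul,
    hW, Matrix.smul_mul, Matrix.one_mul, sub_self, Matrix.mul_zero, sub_zero]

theorem one_kronecker_mul_eq_self {P G : Matrix (Fin dB) (Fin dB) ℂ} {κ : ℝ}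
    (hP : P = 1 - G * (S.obsB 0 * S.obsB 1 + S.obsB 1 * S.obsB 0 - κ • 1))
    (hW : (S.jointB 0 * S.jointB 1 + S.jointB 1 * S.jointB 0) * W = κ • W) :
    ((1 : Matrix (Fin dA) (Fin dA) ℂ) ⊗ₖ P) * W = W := by
  have e : (1 : Matrix (Fin dA) (Fin dA) ℂ) ⊗ₖ
      (S.obsB 0 * S.obsB 1 + S.obsB 1 * S.obsB 0 - κ • 1) =
      S.jointB 0 * S.jointB 1 + S.jointB 1 * S.jointB 0 - κ • 1 := by
    simp only [jointB, ← mul_kronecker_mul, mul_one, kronecker_sub, kronecker_add, kronecker_smul,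
      one_kronecker_one]
  have e' : (1 : Matrix (Fin dA) (Fin dA) ℂ) ⊗ₖ
      (G * (S.obsB 0 * S.obsB 1 + S.obsB 1 * S.obsB 0 - κ • 1)) =
      (1 ⊗ₖ G) * (S.jointB 0 * S.jointB 1 + S.jointB 1 * S.jointB 0 - κ • 1) := by
    rw [← e, ← mul_kronecker_mul, mul_one]
  rw [hP, kronecker_sub, one_kronecker_one, e', Matrix.sub_mul, Matrix.mul_assoc, Matrix.sub_mul,
    hW, Matrix.smul_mul, Matrix.one_mul, sub_self, Matrix.mul_zero, sub_zero]

end QStrategy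

theorem opOf_intertwining {d k : ℕ} {O : Fin 2 → Matrix (Fin d) (Fin d) ℂ}
    {T : Fin 2 → Matrix (Fin 2) (Fin 2) ℂ} {V : Matrix (Fin 2 × Fin k) (Fin d) ℂ}
    {P : Matrix (Fin d) (Fin d) ℂ}
    (h : ∀ x, V * (O x * P) = (T x ⊗ₖ (1 : Matrix (Fin k) (Fin k) ℂ)) * (V * P)) :
    ∀ x : Option (Fin 2),
      V * (opOf O x * P) = (opOf T x ⊗ₖ (1 : Matrix (Fin k) (Fin k) ℂ)) * (V * P)
  | none => by simp [opOf]
  | some x => h x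

/-- Local isometries that intertwine the observables with the target ones on the supports `P`, `Q`
of the state do so on the state. -/
theorem kronecker_mul_kronecker_mul_of_intertwining {dA dB kA kB : ℕ} {E : Type*}
    {W : Matrix (Fin dA × Fin dB) E ℂ}
    {VA : Matrix (Fin 2 × Fin kA) (Fin dA) ℂ} {VB : Matrix (Fin 2 × Fin kB) (Fin dB) ℂ}
    {P A : Matrix (Fin dA) (Fin dA) ℂ} {Q B : Matrix (Fin dB) (Fin dB) ℂ}
    {T U : Matrix (Fin 2) (Fin 2) ℂ}
    (hP : (P ⊗ₖ (1 : Matrix (Fin dB) (Fin dB) ℂ)) * W = W)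
    (hQ : ((1 : Matrix (Fin dA) (Fin dA) ℂ) ⊗ₖ Q) * W = W)
    (hA : VA * (A * P) = (T ⊗ₖ (1 : Matrix (Fin kA) (Fin kA) ℂ)) * (VA * P))
    (hB : VB * (B * Q) = (U ⊗ₖ (1 : Matrix (Fin kB) (Fin kB) ℂ)) * (VB * Q)) :
    (VA ⊗ₖ VB) * ((A ⊗ₖ B) * W) =
      ((T ⊗ₖ (1 : Matrix (Fin kA) (Fin kA) ℂ)) ⊗ₖ (U ⊗ₖ (1 : Matrix (Fin kB) (Fin kB) ℂ))) *
        ((VA ⊗ₖ VB) * W) := by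
  have hPQ : (P ⊗ₖ Q) * W = W := by
    conv_rhs => rw [← hP, ← hQ]
    rw [← Matrix.mul_assoc, ← mul_kronecker_mul, mul_one, one_mul]
  conv_lhs => rw [← hPQ]
  conv_rhs => rw [← hPQ]
  simp only [← Matrix.mul_assoc, ← mul_kronecker_mul]
  rw [Matrix.mul_assoc VA, Matrix.mul_assoc VB, hA, hB, Matrix.mul_assoc _ VA,
    Matrix.mul_assoc _ VB]

/-- The amplitudes of a joint eigenvector: the two optimality relations, read off for the target
observables, leave only a multiple of the target state. -/
theorem amplitudes_of_optimal {θ φ ω : ℝ} (hθ : Real.sin θ ≠ 0) (hs : Real.sin (ω - φ) ≠ 0)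
    {kA kB : ℕ} {E : Type*} {Φ : Matrix ((Fin 2 × Fin kA) × (Fin 2 × Fin kB)) E ℂ}
    (h0 : Real.sin (ω - φ) • (((targetA θ 0 ⊗ₖ (1 : Matrix (Fin kA) (Fin kA) ℂ)) ⊗ₖ
          ((1 : Matrix (Fin 2) (Fin 2) ℂ) ⊗ₖ (1 : Matrix (Fin kB) (Fin kB) ℂ))) * Φ) =
      Real.cos φ • ((((1 : Matrix (Fin 2) (Fin 2) ℂ) ⊗ₖ (1 : Matrix (Fin kA) (Fin kA) ℂ)) ⊗ₖ
          (targetB φ ω 1 ⊗ₖ (1 : Matrix (Fin kB) (Fin kB) ℂ))) * Φ) -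
      Real.cos ω • ((((1 : Matrix (Fin 2) (Fin 2) ℂ) ⊗ₖ (1 : Matrix (Fin kA) (Fin kA) ℂ)) ⊗ₖ
          (targetB φ ω 0 ⊗ₖ (1 : Matrix (Fin kB) (Fin kB) ℂ))) * Φ))
    (h1 : Real.sin (ω - φ) • (((targetA θ 1 ⊗ₖ (1 : Matrix (Fin kA) (Fin kA) ℂ)) ⊗ₖ
          ((1 : Matrix (Fin 2) (Fin 2) ℂ) ⊗ₖ (1 : Matrix (Fin kB) (Fin kB) ℂ))) * Φ) =
      Real.cos (θ + φ) • ((((1 : Matrix (Fin 2) (Fin 2) ℂ) ⊗ₖ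
          (1 : Matrix (Fin kA) (Fin kA) ℂ)) ⊗ₖ
          (targetB φ ω 1 ⊗ₖ (1 : Matrix (Fin kB) (Fin kB) ℂ))) * Φ) -
      Real.cos (θ + ω) • ((((1 : Matrix (Fin 2) (Fin 2) ℂ) ⊗ₖ
          (1 : Matrix (Fin kA) (Fin kA) ℂ)) ⊗ₖ
          (targetB φ ω 0 ⊗ₖ (1 : Matrix (Fin kB) (Fin kB) ℂ))) * Φ))
    (s : Fin kA) (t : Fin kB) (e : E) :
    Φ ((0, s), (1, t)) e = 0 ∧ Φ ((1, s), (0, t)) e = 0 ∧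
      Φ ((1, s), (1, t)) e = Complex.I * Φ ((0, s), (0, t)) e := by
  have hs' : ((Real.sin (ω - φ) : ℝ) : ℂ) ≠ 0 := by exact_mod_cast hs
  have hθ' : ((Real.sin θ : ℝ) : ℂ) ≠ 0 := by exact_mod_cast hθ
  have ts : ((Real.sin (ω - φ) : ℝ) : ℂ) =
      Real.sin ω * Real.cos φ - Real.cos ω * Real.sin φ := by
    exact_mod_cast Real.sin_sub ω φ
  have ta : ∀ z, ((Real.cos (θ + z) : ℝ) : ℂ) =
      Real.cos θ * Real.cos z - Real.sin θ * Real.sin z := by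
    intro z
    exact_mod_cast Real.cos_add θ z
  have p00 := congrFun (congrFun h0 ((0, s), (0, t))) e
  have p10 := congrFun (congrFun h0 ((1, s), (0, t))) e
  have q00 := congrFun (congrFun h1 ((0, s), (0, t))) e
  simp only [Matrix.smul_apply, Matrix.sub_apply, qubit_kronecker_mul_apply, Fin.sum_univ_two,
    targetA_eq, targetB_eq, xyObs_apply, Matrix.cons_val_zero, Matrix.cons_val_one,
    Complex.real_smul, Matrix.of_apply, Matrix.one_apply_eq, Matrix.one_apply_ne, ne_eq,
    zero_ne_one, one_ne_zero, not_false_eq_true, Real.cos_zero, Real.sin_zero,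
    Complex.ofReal_zero, Complex.ofReal_one, zero_mul, mul_zero, one_mul, mul_one, zero_add,
    add_zero, sub_zero] at p00 p10 q00
  set f00 := Φ ((0, s), (0, t)) e
  set f01 := Φ ((0, s), (1, t)) e
  set f10 := Φ ((1, s), (0, t)) e
  set f11 := Φ ((1, s), (1, t)) e
  have r10 : f10 = -Complex.I * f01 := by
    refine mul_left_cancel₀ hs' ?_
    linear_combination p00 + Complex.I * f01 * ts
  have r00 : f00 = -Complex.I * f11 := by
    refine mul_left_cancel₀ hs' ?_
    linear_combination p10 + Complex.I * f11 * ts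
  have r01 : f01 = 0 := by
    rw [r10, ta, ta] at q00
    refine (mul_eq_zero.mp (?_ : ((Real.sin (ω - φ) : ℝ) * (Real.sin θ : ℝ) : ℂ) * f01 = 0)
      ).resolve_left (mul_ne_zero hs' hθ')
    -- With `f10 = -i f01` the relation reads `-i exp (-iθ) f01 = -i exp (iθ) f01`.
    linear_combination (-1 / 2 : ℂ) * q00 +
      (1 / 2 : ℂ) * (Real.sin θ - Complex.I * Real.cos θ) * f01 * ts +
      (1 / 2 : ℂ) * Real.sin (ω - φ) * f01 * Real.sin θ * Complex.I_sq
  refine ⟨r01, by rw [r10, r01, mul_zero], ?_⟩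
  rw [r00]
  linear_combination f11 * Complex.I_sq

/-- An isometry preserves the norm of a normalised vector, written as a matrix. -/
theorem sum_norm_sq_isometry_mul {n m E : Type*} [Fintype n] [DecidableEq n] [Fintype m]
    [Fintype E] {V : Matrix m n ℂ} (hV : Vᴴ * V = 1) {W : Matrix n E ℂ}
    (hW : (W * Wᴴ).trace = 1) : ∑ k, ∑ e, ‖(V * W) k e‖ ^ 2 = 1 := by
  have h : ((V * W) * (V * W)ᴴ).trace = 1 := by
    rw [Matrix.trace_mul_comm, conjTranspose_mul, Matrix.mul_assoc, ← Matrix.mul_assoc Vᴴ, hV,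
      Matrix.one_mul, Matrix.trace_mul_comm, hW]
  have h' : ((∑ k, ∑ e, ‖(V * W) k e‖ ^ 2 : ℝ) : ℂ) = 1 := by
    rw [← h, Matrix.trace]
    push_cast
    refine Finset.sum_congr rfl fun k _ => ?_
    rw [Matrix.diag_apply, Matrix.mul_apply]
    refine Finset.sum_congr rfl fun e _ => ?_
    rw [conjTranspose_apply, ← Complex.mul_conj', Complex.star_def]
  exact_mod_cast h'

/-- The isometries are built from the observables of the strategy alone, so that they serve all
purifications at once. -/
theorem selfTests_target {θ φ ω : ℝ}
    (h : Real.cos (θ + φ) * Real.cos φ * Real.cos (θ + ω) * Real.cos ω < 0) :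
    SelfTests (bell θ φ ω) (etaQ θ φ ω) targetState (targetA θ) (targetB φ ω) := by
  intro dA dB S hS
  obtain ⟨hθ, hs⟩ := sin_ne_zero_of_cos_prod_neg h
  have hac : Real.cos (θ + φ) * Real.cos φ ≠ 0 := by
    intro h0
    rw [h0] at h
    simp at h
  have hcd : Real.cos φ * Real.cos ω ≠ 0 := by
    intro h0
    rw [show Real.cos (θ + φ) * Real.cos φ * Real.cos (θ + ω) * Real.cos ω =
      Real.cos (θ + φ) * Real.cos (θ + ω) * (Real.cos φ * Real.cos ω) by ring, h0] at h
    simp at h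
  obtain ⟨VA, P, GA, hVA, hP, hAint⟩ := exists_isometry_intertwining (O := S.obsA)
    S.isHermitian_obsA S.obsA_mul_self (α := ![0, θ]) (by simpa using hθ)
  obtain ⟨VB, Q, GB, hVB, hQ, hBint⟩ := exists_isometry_intertwining (O := S.obsB)
    S.isHermitian_obsB S.obsB_mul_self (α := ![φ, ω]) (by simpa using hs)
  refine ⟨dA, dB, VA, VB, hVA, hVB, fun dE Ψ hΨ => ?_⟩
  set W := reshape Ψ with hWdef
  have hW : W * Wᴴ = S.ρ := reshape_mul_conjTranspose hΨ
  obtain ⟨h0, h1⟩ := S.defect_mul_eq_zero h hS hW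
  have hPW := S.kronecker_one_mul_eq_self hP
    (by simpa using S.anticommutator_jointA_mul h0 h1 hs hac)
  have hQW := S.one_kronecker_mul_eq_self hQ
    (by simpa using S.anticommutator_jointB_mul h0 hcd)
  have hA := opOf_intertwining (T := targetA θ) fun x => by rw [hAint x, targetA_eq]
  have hB := opOf_intertwining (T := targetB φ ω) fun y => by rw [hBint y, targetB_eq]
  have key := fun x y => kronecker_mul_kronecker_mul_of_intertwining hPW hQW (hA x) (hB y)
  set Φ := (VA ⊗ₖ VB) * W with hΦ
  have kA : ∀ x, (VA ⊗ₖ VB) * (S.jointA x * W) =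
      ((targetA θ x ⊗ₖ (1 : Matrix (Fin dA) (Fin dA) ℂ)) ⊗ₖ
        ((1 : Matrix (Fin 2) (Fin 2) ℂ) ⊗ₖ (1 : Matrix (Fin dB) (Fin dB) ℂ))) * Φ :=
    fun x => key (some x) none
  have kB : ∀ y, (VA ⊗ₖ VB) * (S.jointB y * W) =
      (((1 : Matrix (Fin 2) (Fin 2) ℂ) ⊗ₖ (1 : Matrix (Fin dA) (Fin dA) ℂ)) ⊗ₖ
        (targetB φ ω y ⊗ₖ (1 : Matrix (Fin dB) (Fin dB) ℂ))) * Φ :=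
    fun y => key none (some y)
  have amp := amplitudes_of_optimal (Φ := Φ) (θ := θ) (φ := φ) (ω := ω) hθ hs
    (by
      have e := congrArg (fun M => (VA ⊗ₖ VB) * M) (S.smul_jointA_zero_mul h0)
      simp only [Matrix.mul_smul, Matrix.sub_mul, Matrix.mul_sub, Matrix.smul_mul, kA, kB] at e
      exact e)
    (by
      have e := congrArg (fun M => (VA ⊗ₖ VB) * M) (S.smul_jointA_one_mul h1)
      simp only [Matrix.mul_smul, Matrix.sub_mul, Matrix.mul_sub, Matrix.smul_mul, kA, kB] at e
      exact e)
  have hr : ((Real.sqrt 2 : ℝ) : ℂ) ≠ 0 := by simp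
  have hψ : ∀ i j s t e, Φ ((i, s), (j, t)) e =
      (((Real.sqrt 2 : ℝ) : ℂ) * Φ ((0, s), (0, t)) e) * targetState (i, j) := by
    intro i j s t e
    obtain ⟨a01, a10, a11⟩ := amp s t e
    fin_cases i <;> fin_cases j <;> simp [targetState, a01, a10, a11] <;> field_simp
  refine ⟨fun k => ((Real.sqrt 2 : ℝ) : ℂ) * Φ ((0, k.2.1), (0, k.2.2)) k.1, ?_, ?_⟩
  · have hn := sum_norm_sq_isometry_mul (V := VA ⊗ₖ VB) (W := W)
      (by rw [conjTranspose_kronecker, ← mul_kronecker_mul, hVA, hVB, one_kronecker_one])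
      (by rw [hW, S.trace_eq_one])
    rw [← hΦ] at hn
    rw [IsUnitVec, ← hn]
    have n01 : ∀ s t e, ‖Φ ((0, s), (1, t)) e‖ = 0 := fun s t e => by
      rw [(amp s t e).1, norm_zero]
    have n10 : ∀ s t e, ‖Φ ((1, s), (0, t)) e‖ = 0 := fun s t e => by
      rw [(amp s t e).2.1, norm_zero]
    have n11 : ∀ s t e, ‖Φ ((1, s), (1, t)) e‖ = ‖Φ ((0, s), (0, t)) e‖ := fun s t e => by
      rw [(amp s t e).2.2, norm_mul, Complex.norm_I, one_mul]
    have nr : ‖((Real.sqrt 2 : ℝ) : ℂ)‖ ^ 2 = 2 := by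
      rw [Complex.norm_real, Real.norm_eq_abs, sq_abs, Real.sq_sqrt (by norm_num)]
    simp only [Fintype.sum_prod_type, Fin.sum_univ_two, n01, n10, n11, norm_mul, mul_pow, nr,
      ← Finset.mul_sum]
    rw [Finset.sum_comm]
    simp only [Finset.sum_comm (s := (Finset.univ : Finset (Fin dE)))]
    simp
    ring
  · intro x y e i j s t
    rw [one_kronecker_mulVec_apply, reshape_one_kronecker_mulVec, ← hWdef, key,
      qubit_kronecker_mul_apply]
    simp only [Matrix.mulVec, dotProduct, Fintype.sum_prod_type, kroneckerMap_apply,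
      Finset.mul_sum]
    refine Finset.sum_congr rfl fun i' _ => Finset.sum_congr rfl fun j' _ => ?_
    rw [hψ i' j']
    ring

end BellSelfTest

open BellSelfTest in
theorem proposition1 (θ φ ω : ℝ) :
    -- (i) the local bounds
    (IsGreatest {v : ℝ | ∃ p : Behaviour, IsLocal p ∧ bell θ φ ω p = v} (etaL θ φ ω) ∧
      IsLeast {v : ℝ | ∃ p : Behaviour, IsLocal p ∧ bell θ φ ω p = v} (-etaL θ φ ω)) ∧
    -- (ii) the quantum bounds
    (Real.cos (θ + φ) * Real.cos φ * Real.cos (θ + ω) * Real.cos ω < 0 →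
      IsGreatest {v : ℝ | ∃ p : Behaviour, IsQuantum p ∧ bell θ φ ω p = v} |etaQ θ φ ω| ∧
      IsLeast {v : ℝ | ∃ p : Behaviour, IsQuantum p ∧ bell θ φ ω p = v} (-|etaQ θ φ ω|)) ∧
    -- (iii) the gap
    (etaL θ φ ω < |etaQ θ φ ω| ↔
      Real.cos (θ + φ) * Real.cos φ * Real.cos (θ + ω) * Real.cos ω < 0) ∧
    -- (iv) the target strategy attains the quantum bound, and every strategy that does is
    -- equivalent to it up to local isometries
    (Real.cos (θ + φ) * Real.cos φ * Real.cos (θ + ω) * Real.cos ω < 0 →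
      (∃ S : QStrategy 2 2,
        S.ρ = Matrix.vecMulVec targetState (star targetState) ∧
        S.obsA = targetA θ ∧ S.obsB = targetB φ ω ∧
        bell θ φ ω S.behaviour = etaQ θ φ ω) ∧
      SelfTests (bell θ φ ω) (etaQ θ φ ω) targetState (targetA θ) (targetB φ ω)) := by
  refine ⟨⟨⟨?_, ?_⟩, ⟨?_, ?_⟩⟩, fun h => ⟨⟨?_, ?_⟩, ⟨?_, ?_⟩⟩, etaL_lt_abs_etaQ_iff θ φ ω,
    fun h => ⟨⟨planarStrategy ![0, θ] ![φ, ω], rfl, ?_, ?_, bell_planarStrategy θ φ ω⟩,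
      selfTests_target h⟩⟩
  · simpa using exists_isLocal_bell_eq θ φ ω (ε := 1) (by simp)
  · rintro _ ⟨p, hp, rfl⟩
    exact (abs_le.mp (abs_bell_le_etaL hp)).2
  · simpa using exists_isLocal_bell_eq θ φ ω (ε := -1) (by simp)
  · rintro _ ⟨p, hp, rfl⟩
    exact (abs_le.mp (abs_bell_le_etaL hp)).1
  · rcases abs_choice (etaQ θ φ ω) with e | e <;> rw [e]
    · exact ⟨_, ⟨2, 2, _, rfl⟩, bell_planarStrategy θ φ ω⟩
    · exact ⟨_, ⟨2, 2, _, rfl⟩, bell_planarStrategy_add_pi θ φ ω⟩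
  · rintro _ ⟨_, ⟨dA, dB, S, rfl⟩, rfl⟩
    exact (abs_le.mp (S.abs_bell_le_abs_etaQ h)).2
  · rcases abs_choice (etaQ θ φ ω) with e | e <;> rw [e]
    · exact ⟨_, ⟨2, 2, _, rfl⟩, bell_planarStrategy_add_pi θ φ ω⟩
    · rw [neg_neg]
      exact ⟨_, ⟨2, 2, _, rfl⟩, bell_planarStrategy θ φ ω⟩
  · rintro _ ⟨_, ⟨dA, dB, S, rfl⟩, rfl⟩
    exact (abs_le.mp (S.abs_bell_le_abs_etaQ h)).1
  · funext x
    rw [obsA_planarStrategy, targetA_eq]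
  · funext y
    rw [obsB_planarStrategy, targetB_eq]
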